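/- Let $X$ be a complex manifold of positive dimension with a Kähler metric $\omega=\sqrt{-1}\,g_{\alpha\bar\beta}\,dz^\alpha\wedge d\bar z^{\beta}$; the associated Riemannian metric is $g(u,v)=\omega(u,Jv)$, i.e. $g=2\,\mathrm{Re}\,(g_{\alpha\bar\beta}\,dz^\alpha\otimes d\bar z^\beta)$, where $J$ is the complex structure. Let $V\subset X$ be a non-empty open set and $\varphi\colon V\to\mathbb R$ a smooth function that is a local potential of $\omega$, i.e. $\sqrt{-1}\,\partial\bar\partial\varphi=\omega$ on $V$ (equivalently $\varphi_{\alpha\bar\beta}=g_{\alpha\bar\beta}$ in holomorphic coordinates). Let $\mathcal V=\varphi^\alpha\partial_\alpha$, $\varphi^\alpha=g^{\alpha\bar\beta}\varphi_{\bar\beta}$, be its $(1,0)$-gradient vector field, and suppose that its length is constant: $$|\partial\varphi|_\omega^2=\varphi_\alpha\varphi_{\bar\beta}g^{\alpha\bar\beta}\equiv C\quad\text{on }V.$$ Then $C>0$, and the real distribution $D\subset TX|_V$ generated by $\mathcal V$, i.e. spanned over $\mathbb R$ by $\mathcal V+\overline{\mathcal V}$ and $\sqrt{-1}(\mathcal V-\overline{\mathcal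 V})$, has constant rank $2$ and is involutive: the Lie bracket of two smooth local sections of $D$ is again a section of $D$. Moreover, every integral submanifold of $D$ (a smooth surface $S$ with a smooth immersion $\iota\colon S\to X$, $\iota(S)\subset V$, $d\iota(T_sS)=D_{\iota(s)}$ for all $s\in S$) is a holomorphic curve (around every point $S$ has a smooth complex coordinate in which $\iota$ is holomorphic), is totally geodesic in $(X,g)$ (its second fundamental form vanishes), and its induced metric $\iota^*g$ has constant Gaussian curvature $$\kappa\equiv-\frac{2}{C}.$$ -/

import Mathlib

open scoped Manifold ContDiff

noncomputable section

namespace KahlerGrad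

/-! ### Riemannian metrics on open subsets of a real normed space

A metric on (an open subset of) `F` is given by its coefficients `G : F → F →L[ℝ] F →L[ℝ] ℝ`;
only the germ of `G` at the point under consideration matters. -/

section Local

variable {F : Type*} [NormedAddCommGroup F] [NormedSpace ℝ F]

/-- The Christoffel map `Γ_y(u, v)` of the Levi-Civita connection of the metric `G`: the vector
with `G_y(Γ_y(u, v), w) = (∂_u G(v, w) + ∂_v G(u, w) - ∂_w G(u, v)) / 2` for all `w`.
Here `(G y).inverse` is the inverse of the isomorphism `v ↦ G_y(v, ·)` from vectors to covectors.
For constant vector fields `u, v` one has `∇_u v = Γ(u, v)`. -/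
def christoffel (G : F → F →L[ℝ] F →L[ℝ] ℝ) (y u v : F) : F :=
  (G y).inverse ((1 / 2 : ℝ) •
    (fderiv ℝ G y u v + fderiv ℝ G y v u - ((fderiv ℝ G y).flip u).flip v))

/-- The curvature tensor `R(u, v) w = ∇_u ∇_v w - ∇_v ∇_u w` (`u, v, w` constant fields). -/
def curvature (G : F → F →L[ℝ] F →L[ℝ] ℝ) (y u v w : F) : F :=
  fderiv ℝ (fun x => christoffel G x v w) y u - fderiv ℝ (fun x => christoffel G x u w) y v
    + christoffel G y u (christoffel G y v w) - christoffel G y v (christoffel G y u w)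

/-- The sectional curvature of the plane spanned by `u, v`. -/
def sectionalCurvature (G : F → F →L[ℝ] F →L[ℝ] ℝ) (y u v : F) : ℝ :=
  G y (curvature G y u v v) u / (G y u u * G y v v - G y u v ^ 2)

/-- The Gaussian curvature of a Riemannian metric on an open subset of the real plane `ℂ`. -/
def gaussianCurvature (G : ℂ → ℂ →L[ℝ] ℂ →L[ℝ] ℝ) (z : ℂ) : ℝ :=
  sectionalCurvature G z 1 Complex.I

end Local

section Manifold

variable {E : Type*} [NormedAddCommGroup E] [NormedSpace ℂ E]

/-- The coefficient form of `√-1 ∂∂̄ f`, i.e. the sesquilinear form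
`(u, v) ↦ ∑ (∂²f / ∂z^α ∂z̄^β) u^α conj (v^β)`. With `∂_u = (D_u - √-1 D_{√-1 u}) / 2` and
`∂̄_v = (D_v + √-1 D_{√-1 v}) / 2`, it is `∂_u ∂̄_v f`. -/
def complexHessian (f : E → ℝ) (y u v : E) : ℂ :=
  let H := fderiv ℝ (fderiv ℝ f) y
  (((H u v + H (Complex.I • u) (Complex.I • v)) / 4 : ℝ) : ℂ) +
    (((H u (Complex.I • v) - H (Complex.I • u) v) / 4 : ℝ) : ℂ) * Complex.I

variable {X : Type*} [TopologicalSpace X] [ChartedSpace E X]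

/-- A complex manifold is a real analytic, hence smooth, manifold. -/
instance realManifold [IsManifold 𝓘(ℂ, E) ω X] : IsManifold 𝓘(ℝ, E) ω X := by
  refine isManifold_of_contDiffOn _ _ _ fun e e' he he' => ?_
  have h0 : e.symm ≫ₕ e' ∈ contDiffGroupoid ω 𝓘(ℂ, E) := HasGroupoid.compatible he he'
  rw [contDiffGroupoid, mem_groupoid_of_pregroupoid] at h0
  have h : ContDiffOn ℂ ω (𝓘(ℂ, E) ∘ (e.symm ≫ₕ e') ∘ 𝓘(ℂ, E).symm)
    (𝓘(ℂ, E).symm ⁻¹' (e.symm ≫ₕ e').source ∩ Set.range 𝓘(ℂ, E)) := h0.1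
  exact h.restrict_scalars ℝ

/-- The complex structure on the real tangent spaces of a complex manifold. The real tangent
space at `p` is identified with `E` through the preferred holomorphic chart at `p`. -/
def J (p : X) : TangentSpace 𝓘(ℝ, E) p →L[ℝ] TangentSpace 𝓘(ℝ, E) p :=
  (Complex.I • ContinuousLinearMap.id ℝ E : E →L[ℝ] E)

/-- The pull-back of a family of bilinear forms on the (real) tangent spaces of `X` under a
map `f` from a real normed space `F`. Applied to the inverse of a chart this gives the
coefficients in the chart; applied to a parametrization of a submanifold it gives the
coefficients of the induced metric. -/
def pullback {F : Type*} [NormedAddCommGroup F] [NormedSpace ℝ F]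
    (g : ∀ p : X, TangentSpace 𝓘(ℝ, E) p →L[ℝ] TangentSpace 𝓘(ℝ, E) p →L[ℝ] ℝ)
    (f : F → X) (y : F) : F →L[ℝ] F →L[ℝ] ℝ :=
  let df : F →L[ℝ] E := mfderiv 𝓘(ℝ, F) 𝓘(ℝ, E) f y
  let B : E →L[ℝ] E →L[ℝ] ℝ := g (f y)
  B.bilinearComp df df

/-- A Kähler metric on the complex manifold `X`: a smooth Riemannian metric `g` (on the real
tangent bundle) for which the complex structure is orthogonal, and such that the Kähler form
`ω(u, v) = g(J u, v)` is closed (in every holomorphic chart, `dω = 0`). -/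
structure KahlerMetric (E : Type*) [NormedAddCommGroup E] [NormedSpace ℂ E]
    (X : Type*) [TopologicalSpace X] [ChartedSpace E X] [IsManifold 𝓘(ℂ, E) ω X]
    extends Bundle.ContMDiffRiemannianMetric 𝓘(ℝ, E) ∞ E
      (fun p : X => TangentSpace 𝓘(ℝ, E) p) where
  inner_J : ∀ (p : X) (u v : TangentSpace 𝓘(ℝ, E) p), inner p (J p u) (J p v) = inner p u v
  closed : ∀ c ∈ atlas E X, ∀ y ∈ c.target, ∀ u v w : E,
    let Ω : E → E →L[ℝ] E →L[ℝ] ℝ := pullback (fun p => (inner p).comp (J p)) c.symm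
    fderiv ℝ Ω y u v w + fderiv ℝ Ω y v w u + fderiv ℝ Ω y w u v = 0

namespace KahlerMetric

variable [IsManifold 𝓘(ℂ, E) ω X] (K : KahlerMetric E X)

/-- The hermitian form `h(u, v) = g_{αβ̄} u^α conj (v^β) = ⟨u^{1,0}, conj (v^{1,0})⟩`, where a real
tangent vector `u` is identified with its `(1,0)`-part `u^{1,0} = (u - √-1 J u) / 2`, so that
`u = u^{1,0} + conj u^{1,0}`. One has `g = 2 Re h` and `ω = √-1 g_{αβ̄} dz^α ∧ dz̄^β = -2 Im h`. -/
def herm (p : X) (u v : TangentSpace 𝓘(ℝ, E) p) : ℂ :=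
  ((K.inner p u v / 2 : ℝ) : ℂ) + ((K.inner p u (J p v) / 2 : ℝ) : ℂ) * Complex.I

/-- The real differential of a function. -/
def _root_.KahlerGrad.dReal (φ : X → ℝ) (p : X) : TangentSpace 𝓘(ℝ, E) p →L[ℝ] ℝ :=
  mfderiv 𝓘(ℝ, E) 𝓘(ℝ, ℝ) φ p

/-- The `(1,0)`-form `∂φ`, evaluated at the `(1,0)`-part of a real tangent vector. -/
def _root_.KahlerGrad.del (φ : X → ℝ) (p : X) (v : TangentSpace 𝓘(ℝ, E) p) : ℂ :=
  ((dReal φ p v / 2 : ℝ) : ℂ) - ((dReal φ p (J p v) / 2 : ℝ) : ℂ) * Complex.I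

/-- `φ` is a local potential of the Kähler form on the open set `V`: it is smooth there and
`√-1 ∂∂̄ φ = ω`, i.e. `φ_{αβ̄} = g_{αβ̄}` in every holomorphic chart. -/
structure IsLocalPotential (φ : X → ℝ) (V : Set X) : Prop where
  isOpen : IsOpen V
  smooth : ContMDiffOn 𝓘(ℝ, E) 𝓘(ℝ, ℝ) ∞ φ V
  complexHessian_eq : ∀ c ∈ atlas E X, ∀ y ∈ c.target, c.symm y ∈ V → ∀ u v : E,
    complexHessian (φ ∘ c.symm) y u v =
      K.herm (c.symm y) (mfderiv 𝓘(ℝ, E) 𝓘(ℝ, E) c.symm y u)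
        (mfderiv 𝓘(ℝ, E) 𝓘(ℝ, E) c.symm y v)

/-- The Riemannian gradient of `φ`. Its `(1,0)`-part is the gradient field `𝒱 = φ^α ∂_α`, so
this is the real vector field `𝒱 + conj 𝒱` that represents `𝒱`. -/
def grad (φ : X → ℝ) (p : X) : TangentSpace 𝓘(ℝ, E) p :=
  (K.inner p).inverse (dReal φ p)

/-- The gradient length `|∂φ|² = φ_α φ_β̄ g^{αβ̄} = ⟨𝒱, conj 𝒱⟩`. -/
def gradLengthSq (φ : X → ℝ) (p : X) : ℝ :=
  (K.herm p (K.grad φ p) (K.grad φ p)).re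

/-- The real distribution generated by `𝒱`: it is spanned over `ℝ` by `𝒱 + conj 𝒱` and
`√-1 (𝒱 - conj 𝒱) = J (𝒱 + conj 𝒱)`. -/
def gradDistribution (φ : X → ℝ) (p : X) : Submodule ℝ (TangentSpace 𝓘(ℝ, E) p) :=
  Submodule.span ℝ {K.grad φ p, J p (K.grad φ p)}

/-- The gradient field is the one with `∂φ(v) = ⟨v, conj 𝒱⟩` for all `(1,0)`-vectors `v`. -/
theorem del_eq_herm_grad [FiniteDimensional ℂ E] (φ : X → ℝ) (p : X)
    (v : TangentSpace 𝓘(ℝ, E) p) : del φ p v = K.herm p v (K.grad φ p) := by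
  have key : ∀ w, K.inner p w (K.grad φ p) = dReal φ p w := by
    intro w
    have : FiniteDimensional ℝ E := FiniteDimensional.complexToReal E
    let B : E →L[ℝ] E →L[ℝ] ℝ := K.inner p
    have inj : Function.Injective B := by
      refine (injective_iff_map_eq_zero B).2 fun x hx => ?_
      by_contra h
      have h1 : 0 < B x x := K.pos p x h
      rw [hx] at h1
      simp at h1
    have hdim : Module.finrank ℝ E = Module.finrank ℝ (E →L[ℝ] ℝ) := by
      rw [← (LinearMap.toContinuousLinearMap : (E →ₗ[ℝ] ℝ) ≃ₗ[ℝ] _).finrank_eq,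
        Module.finrank_linearMap_self]
    let L := (LinearEquiv.ofInjectiveOfFinrankEq (B : E →ₗ[ℝ] E →L[ℝ] ℝ) inj
      hdim).toContinuousLinearEquiv
    have hL : (L : E →L[ℝ] E →L[ℝ] ℝ) = B := by ext; rfl
    have h2 : B (B.inverse (dReal φ p)) = dReal φ p := by
      rw [← hL, ContinuousLinearMap.inverse_equiv]
      exact L.apply_symm_apply _
    rw [K.symm]
    exact DFunLike.congr_fun h2 w
  have hJ : K.inner p v (J p (K.grad φ p)) = - K.inner p (J p v) (K.grad φ p) := by
    rw [← K.inner_J p v]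
    have : J p (J p (K.grad φ p)) = - K.grad φ p := by
      let x : E := K.grad φ p
      change Complex.I • Complex.I • x = - x
      rw [smul_smul, Complex.I_mul_I, neg_one_smul]
    rw [this, map_neg]
  rw [del, herm, hJ, key, key]
  push_cast
  ring

/-- An immersion `ι` of a real surface `S` into `X` is totally geodesic: its second fundamental
form vanishes. In charts `e` of `S` and `c` of `X`, with `F = c ∘ ι ∘ e⁻¹`, the covariant
derivative `D²F(a, b) + Γ(DF a, DF b)` of the tangential field `DF b` is again tangential. -/
def IsTotallyGeodesic {S : Type*} [TopologicalSpace S]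
    [ChartedSpace (EuclideanSpace ℝ (Fin 2)) S] (ι : S → X) : Prop :=
  ∀ e ∈ atlas (EuclideanSpace ℝ (Fin 2)) S, ∀ c ∈ atlas E X, ∀ z ∈ e.target,
    ι (e.symm z) ∈ c.source → ∀ a b : EuclideanSpace ℝ (Fin 2),
      let F : EuclideanSpace ℝ (Fin 2) → E := c ∘ ι ∘ e.symm
      fderiv ℝ (fderiv ℝ F) z a b +
        christoffel (pullback K.inner c.symm) (F z) (fderiv ℝ F z a) (fderiv ℝ F z b)
          ∈ (fderiv ℝ F z).range

end KahlerMetric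

/-- The distribution `D` is involutive on the open set `V`: the Lie bracket of two smooth
sections of `D` over an open subset of `V` is a section of `D`. -/
def IsInvolutiveOn [IsManifold 𝓘(ℂ, E) ω X]
    (D : ∀ p : X, Submodule ℝ (TangentSpace 𝓘(ℝ, E) p)) (V : Set X) : Prop :=
  ∀ W ⊆ V, IsOpen W → ∀ A B : ∀ p : X, TangentSpace 𝓘(ℝ, E) p,
    ContMDiffOn 𝓘(ℝ, E) 𝓘(ℝ, E).tangent ∞ (fun p => (⟨p, A p⟩ : TangentBundle 𝓘(ℝ, E) X)) W →
    ContMDiffOn 𝓘(ℝ, E) 𝓘(ℝ, E).tangent ∞ (fun p => (⟨p, B p⟩ : TangentBundle 𝓘(ℝ, E) X)) W →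
    (∀ p ∈ W, A p ∈ D p) → (∀ p ∈ W, B p ∈ D p) →
    ∀ p ∈ W, VectorField.mlieBracket 𝓘(ℝ, E) A B p ∈ D p

/-- `ι : S → X` is an (immersed) integral submanifold, contained in `V`, of the rank 2
distribution `D`: a smooth immersion of a surface whose tangent planes are those of `D`. -/
structure IsIntegralSubmanifold
    (D : ∀ p : X, Submodule ℝ (TangentSpace 𝓘(ℝ, E) p)) (V : Set X)
    {S : Type*} [TopologicalSpace S] [ChartedSpace (EuclideanSpace ℝ (Fin 2)) S]
    (ι : S → X) : Prop where
  smooth : ContMDiff 𝓘(ℝ, EuclideanSpace ℝ (Fin 2)) 𝓘(ℝ, E) ∞ ι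
  mem : ∀ s, ι s ∈ V
  immersion : ∀ s, Function.Injective (mfderiv 𝓘(ℝ, EuclideanSpace ℝ (Fin 2)) 𝓘(ℝ, E) ι s)
  range_eq : ∀ s, (mfderiv 𝓘(ℝ, EuclideanSpace ℝ (Fin 2)) 𝓘(ℝ, E) ι s).range = D (ι s)

/-- A holomorphic coordinate on the surface `S` relative to `ι : S → X`: a local diffeomorphism
`e` from an open subset of `S` onto an open subset of `ℂ` such that `ι ∘ e⁻¹` is holomorphic. -/
structure IsHolomorphicCoordinate (E : Type*) [NormedAddCommGroup E] [NormedSpace ℂ E]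
    {X : Type*} [TopologicalSpace X] [ChartedSpace E X]
    {S : Type*} [TopologicalSpace S] [ChartedSpace (EuclideanSpace ℝ (Fin 2)) S]
    (ι : S → X) (e : OpenPartialHomeomorph S ℂ) : Prop where
  smooth : ContMDiffOn 𝓘(ℝ, EuclideanSpace ℝ (Fin 2)) 𝓘(ℝ, ℂ) ∞ e e.source
  smooth_symm : ContMDiffOn 𝓘(ℝ, ℂ) 𝓘(ℝ, EuclideanSpace ℝ (Fin 2)) ∞ e.symm e.target
  holomorphic : MDifferentiableOn 𝓘(ℂ, ℂ) 𝓘(ℂ, E) (ι ∘ e.symm) e.target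

/-- The immersed surface `ι : S → X` is a holomorphic curve (an immersed one-dimensional complex
submanifold): holomorphic coordinates exist around every point of `S`. (They then form a
holomorphic atlas of `S`, for which `ι` is holomorphic.) -/
def IsHolomorphicCurve (E : Type*) [NormedAddCommGroup E] [NormedSpace ℂ E]
    {X : Type*} [TopologicalSpace X] [ChartedSpace E X]
    {S : Type*} [TopologicalSpace S] [ChartedSpace (EuclideanSpace ℝ (Fin 2)) S]
    (ι : S → X) : Prop :=
  ∀ s : S, ∃ e : OpenPartialHomeomorph S ℂ, IsHolomorphicCoordinate E ι e ∧ s ∈ e.source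

/-- The metric induced on the holomorphic curve `ι : S → X` has constant Gaussian curvature `κ`,
computed in holomorphic coordinates of `S`. -/
def KahlerMetric.HasConstantGaussianCurvature [IsManifold 𝓘(ℂ, E) ω X] (K : KahlerMetric E X)
    {S : Type*} [TopologicalSpace S] [ChartedSpace (EuclideanSpace ℝ (Fin 2)) S]
    (ι : S → X) (κ : ℝ) : Prop :=
  ∀ e : OpenPartialHomeomorph S ℂ, IsHolomorphicCoordinate E ι e → ∀ z ∈ e.target,
    gaussianCurvature (pullback K.inner (ι ∘ e.symm)) z = κ

end Manifold

end KahlerGrad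

end

open scoped Manifold ContDiff

noncomputable section

namespace KahlerGrad

set_option linter.unusedSectionVars false

open Filter Topology

section Inverse

variable {E : Type*} [NormedAddCommGroup E] [NormedSpace ℝ E] [FiniteDimensional ℝ E]

/-- A positive definite bilinear form identifies vectors with covectors. -/
theorem exists_equiv_of_pos (B : E →L[ℝ] E →L[ℝ] ℝ) (hB : ∀ u, u ≠ 0 → 0 < B u u) :
    ∃ L : E ≃L[ℝ] (E →L[ℝ] ℝ), (L : E →L[ℝ] E →L[ℝ] ℝ) = B := by
  have inj : Function.Injective B := by
    refine (injective_iff_map_eq_zero B).2 fun x hx => ?_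
    by_contra h
    have h1 := hB x h
    simp [hx] at h1
  have hdim : Module.finrank ℝ E = Module.finrank ℝ (E →L[ℝ] ℝ) := by
    rw [← (LinearMap.toContinuousLinearMap : (E →ₗ[ℝ] ℝ) ≃ₗ[ℝ] _).finrank_eq,
      Module.finrank_linearMap_self]
  exact ⟨(LinearEquiv.ofInjectiveOfFinrankEq (B : E →ₗ[ℝ] E →L[ℝ] ℝ) inj
    hdim).toContinuousLinearEquiv, by ext; rfl⟩

theorem apply_inverse_of_pos (B : E →L[ℝ] E →L[ℝ] ℝ) (hB : ∀ u, u ≠ 0 → 0 < B u u)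
    (l : E →L[ℝ] ℝ) : B (B.inverse l) = l := by
  obtain ⟨L, rfl⟩ := exists_equiv_of_pos B hB
  rw [ContinuousLinearMap.inverse_equiv]
  exact L.apply_symm_apply _

theorem ext_of_pos (B : E →L[ℝ] E →L[ℝ] ℝ) (hB : ∀ u, u ≠ 0 → 0 < B u u) {u v : E}
    (h : ∀ w, B u w = B v w) : u = v := by
  obtain ⟨L, rfl⟩ := exists_equiv_of_pos B hB
  exact L.injective (ContinuousLinearMap.ext h)

end Inverse

theorem two_le_smoothness : minSmoothness ℝ 2 ≤ (∞ : ℕ∞ω) := by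
  simp only [minSmoothness_of_isRCLikeNormedField]
  exact WithTop.coe_le_coe.2 le_top

theorem fderiv_apply_apply {F M : Type*} [NormedAddCommGroup F] [NormedSpace ℝ F]
    [NormedAddCommGroup M] [NormedSpace ℝ M] {G : M → F →L[ℝ] F →L[ℝ] ℝ}
    {y : M} (h : DifferentiableAt ℝ G y) (a : M) (u v : F) :
    fderiv ℝ (fun x => G x u v) y a = fderiv ℝ G y a u v := by
  have := ((h.hasFDerivAt.clm_apply (hasFDerivAt_const u y)).clm_apply
    (hasFDerivAt_const v y)).fderiv
  rw [this]
  simp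

/-- `f` is a Kähler potential on the open set `U` of the metric with coefficients `G`, and
the `(1,0)`-gradient of `f` has constant length `C`. -/
structure IsPotentialOn {E : Type*} [NormedAddCommGroup E] [NormedSpace ℂ E]
    (f : E → ℝ) (G : E → E →L[ℝ] E →L[ℝ] ℝ) (U : Set E) (C : ℝ) : Prop where
  isOpen : IsOpen U
  smooth : ContDiffOn ℝ ∞ f U
  hessian : ∀ y ∈ U, ∀ u v : E, fderiv ℝ (fderiv ℝ f) y u v +
    fderiv ℝ (fderiv ℝ f) y (Complex.I • u) (Complex.I • v) = 2 * G y u v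
  pos : ∀ y ∈ U, ∀ u, u ≠ 0 → 0 < G y u u
  length : ∀ y ∈ U, G y ((G y).inverse (fderiv ℝ f y)) ((G y).inverse (fderiv ℝ f y)) = 2 * C

/-- The gradient of `f` with respect to the metric `G`. -/
def localGrad {E : Type*} [NormedAddCommGroup E] [NormedSpace ℝ E]
    (f : E → ℝ) (G : E → E →L[ℝ] E →L[ℝ] ℝ) (y : E) : E :=
  (G y).inverse (fderiv ℝ f y)

/-- The covariant derivative `∇_v ξ` of the gradient field `ξ`. -/
def covGrad {E : Type*} [NormedAddCommGroup E] [NormedSpace ℝ E]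
    (f : E → ℝ) (G : E → E →L[ℝ] E →L[ℝ] ℝ) (y v : E) : E :=
  fderiv ℝ (localGrad f G) y v + christoffel G y v (localGrad f G y)

section Distribution

variable {E : Type*} [NormedAddCommGroup E] [NormedSpace ℂ E]
  {f : E → ℝ} {G : E → E →L[ℝ] E →L[ℝ] ℝ}

theorem I_smul_I_smul (u : E) : Complex.I • Complex.I • u = -u := by
  rw [smul_smul, Complex.I_mul_I, neg_one_smul]

/-- The distribution spanned over `ℝ` by the gradient `ξ` and `√-1 ξ`. -/
def localDistribution (f : E → ℝ) (G : E → E →L[ℝ] E →L[ℝ] ℝ) (y : E) :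
    Submodule ℝ E :=
  Submodule.span ℝ {localGrad f G y, Complex.I • localGrad f G y}

theorem mem_localDistribution {y v : E} :
    v ∈ localDistribution f G y ↔
      ∃ a b : ℝ, a • localGrad f G y + b • Complex.I • localGrad f G y = v :=
  Submodule.mem_span_pair

theorem I_smul_mem_localDistribution {y v : E}
    (hv : v ∈ localDistribution f G y) : Complex.I • v ∈ localDistribution f G y := by
  obtain ⟨a, b, rfl⟩ := mem_localDistribution.1 hv
  refine mem_localDistribution.2 ⟨-b, a, ?_⟩
  rw [smul_add, smul_comm Complex.I a, smul_comm Complex.I b, I_smul_I_smul]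
  simp [add_comm]

end Distribution

namespace IsPotentialOn

variable {E : Type*} [NormedAddCommGroup E] [NormedSpace ℂ E] [FiniteDimensional ℂ E]
  {f : E → ℝ} {G : E → E →L[ℝ] E →L[ℝ] ℝ} {U : Set E} {C : ℝ}

theorem contDiffOn_fderiv (h : IsPotentialOn f G U C) : ContDiffOn ℝ ∞ (fderiv ℝ f) U :=
  h.smooth.fderiv_of_isOpen h.isOpen (by simp)

theorem contDiffOn_fderiv_fderiv (h : IsPotentialOn f G U C) :
    ContDiffOn ℝ ∞ (fderiv ℝ (fderiv ℝ f)) U :=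
  h.contDiffOn_fderiv.fderiv_of_isOpen h.isOpen (by simp)

theorem metric_eq (h : IsPotentialOn f G U C) {y : E} (hy : y ∈ U) (u v : E) :
    G y u v = (1 / 2 : ℝ) * (fderiv ℝ (fderiv ℝ f) y u v +
      fderiv ℝ (fderiv ℝ f) y (Complex.I • u) (Complex.I • v)) := by
  rw [h.hessian y hy]; ring

theorem contDiffOn_metric (h : IsPotentialOn f G U C) : ContDiffOn ℝ ∞ G U := by
  have : FiniteDimensional ℝ E := FiniteDimensional.complexToReal E
  refine contDiffOn_clm_apply.2 fun u => contDiffOn_clm_apply.2 fun v => ?_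
  refine ContDiffOn.congr ?_ fun y hy => h.metric_eq hy u v
  have hH := h.contDiffOn_fderiv_fderiv
  exact contDiffOn_const.mul (((hH.clm_apply contDiffOn_const).clm_apply contDiffOn_const).add
    ((hH.clm_apply contDiffOn_const).clm_apply contDiffOn_const))

theorem contDiffOn_localGrad (h : IsPotentialOn f G U C) : ContDiffOn ℝ ∞ (localGrad f G) U := by
  have : FiniteDimensional ℝ E := FiniteDimensional.complexToReal E
  have : CompleteSpace E := FiniteDimensional.complete ℝ E
  intro y hy
  obtain ⟨L, hL⟩ := exists_equiv_of_pos (G y) (h.pos y hy)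
  have h1 : ContDiffAt ℝ ∞ (fun B : E →L[ℝ] E →L[ℝ] ℝ => B.inverse) (G y) := by
    rw [← hL]; exact contDiffAt_map_inverse L
  have h2 : ContDiffAt ℝ ∞ G y := h.contDiffOn_metric.contDiffAt (h.isOpen.mem_nhds hy)
  have h3 : ContDiffAt ℝ ∞ (fderiv ℝ f) y :=
    h.contDiffOn_fderiv.contDiffAt (h.isOpen.mem_nhds hy)
  exact ((h1.comp y h2).clm_apply h3).contDiffWithinAt

theorem differentiableAt_metric (h : IsPotentialOn f G U C) {y : E} (hy : y ∈ U) :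
    DifferentiableAt ℝ G y :=
  (h.contDiffOn_metric.contDiffAt (h.isOpen.mem_nhds hy)).differentiableAt (by simp)

theorem differentiableAt_localGrad (h : IsPotentialOn f G U C) {y : E} (hy : y ∈ U) :
    DifferentiableAt ℝ (localGrad f G) y :=
  (h.contDiffOn_localGrad.contDiffAt (h.isOpen.mem_nhds hy)).differentiableAt (by simp)

theorem differentiableAt_fderiv_fderiv (h : IsPotentialOn f G U C) {y : E} (hy : y ∈ U) :
    DifferentiableAt ℝ (fderiv ℝ (fderiv ℝ f)) y :=
  (h.contDiffOn_fderiv_fderiv.contDiffAt (h.isOpen.mem_nhds hy)).differentiableAt (by simp)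

theorem hessian_symm (h : IsPotentialOn f G U C) {y : E} (hy : y ∈ U) (u v : E) :
    fderiv ℝ (fderiv ℝ f) y u v = fderiv ℝ (fderiv ℝ f) y v u :=
  ((h.smooth.contDiffAt (h.isOpen.mem_nhds hy)).isSymmSndFDerivAt
    two_le_smoothness).eq u v

theorem third_symm_left (h : IsPotentialOn f G U C) {y : E} (hy : y ∈ U) (u v w : E) :
    fderiv ℝ (fderiv ℝ (fderiv ℝ f)) y u v w = fderiv ℝ (fderiv ℝ (fderiv ℝ f)) y v u w := by
  have := ((h.contDiffOn_fderiv.contDiffAt (h.isOpen.mem_nhds hy)).isSymmSndFDerivAt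
    two_le_smoothness).eq u v
  rw [this]

theorem third_symm_right (h : IsPotentialOn f G U C) {y : E} (hy : y ∈ U) (u v w : E) :
    fderiv ℝ (fderiv ℝ (fderiv ℝ f)) y u v w = fderiv ℝ (fderiv ℝ (fderiv ℝ f)) y u w v := by
  have hd := h.differentiableAt_fderiv_fderiv hy
  rw [← fderiv_apply_apply hd, ← fderiv_apply_apply hd]
  congr 1
  refine Filter.EventuallyEq.fderiv_eq ?_
  filter_upwards [h.isOpen.mem_nhds hy] with x hx using h.hessian_symm hx v w

theorem fderiv_metric (h : IsPotentialOn f G U C) {y : E} (hy : y ∈ U) (a u v : E) :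
    fderiv ℝ G y a u v = (1 / 2 : ℝ) * (fderiv ℝ (fderiv ℝ (fderiv ℝ f)) y a u v +
      fderiv ℝ (fderiv ℝ (fderiv ℝ f)) y a (Complex.I • u) (Complex.I • v)) := by
  have hd := h.differentiableAt_fderiv_fderiv hy
  rw [← fderiv_apply_apply (h.differentiableAt_metric hy)]
  have he : (fun x => G x u v) =ᶠ[𝓝 y] fun x => (1 / 2 : ℝ) * (fderiv ℝ (fderiv ℝ f) x u v +
      fderiv ℝ (fderiv ℝ f) x (Complex.I • u) (Complex.I • v)) := by
    filter_upwards [h.isOpen.mem_nhds hy] with x hx using h.metric_eq hx u v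
  have hd' : ∀ u v : E, DifferentiableAt ℝ (fun x => fderiv ℝ (fderiv ℝ f) x u v) y := fun u v =>
    (hd.clm_apply (differentiableAt_const u)).clm_apply (differentiableAt_const v)
  rw [he.fderiv_eq, fderiv_const_mul ((hd' _ _).fun_add (hd' _ _)), fderiv_fun_add (hd' _ _) (hd' _ _)]
  simp only [smul_apply, add_apply, smul_eq_mul]
  rw [fderiv_apply_apply hd, fderiv_apply_apply hd]

theorem metric_symm (h : IsPotentialOn f G U C) {y : E} (hy : y ∈ U) (u v : E) :
    G y u v = G y v u := by
  rw [h.metric_eq hy, h.metric_eq hy, h.hessian_symm hy, h.hessian_symm hy (Complex.I • u)]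

theorem metric_I_I (h : IsPotentialOn f G U C) {y : E} (hy : y ∈ U) (u v : E) :
    G y (Complex.I • u) (Complex.I • v) = G y u v := by
  rw [h.metric_eq hy, h.metric_eq hy, I_smul_I_smul, I_smul_I_smul]
  simp only [map_neg, neg_apply]
  ring

theorem metric_I_left (h : IsPotentialOn f G U C) {y : E} (hy : y ∈ U) (u v : E) :
    G y (Complex.I • u) v = - G y u (Complex.I • v) := by
  rw [← h.metric_I_I hy u, I_smul_I_smul]
  simp

theorem metric_self_I (h : IsPotentialOn f G U C) {y : E} (hy : y ∈ U) (u : E) :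
    G y u (Complex.I • u) = 0 := by
  have h1 := h.metric_I_left hy u u
  rw [h.metric_symm hy] at h1
  linarith

theorem metric_christoffel (h : IsPotentialOn f G U C) {y : E} (hy : y ∈ U) (u v w : E) :
    G y (christoffel G y u v) w =
      (1 / 2 : ℝ) * (fderiv ℝ G y u v w + fderiv ℝ G y v u w - fderiv ℝ G y w u v) := by
  have : FiniteDimensional ℝ E := FiniteDimensional.complexToReal E
  rw [christoffel, apply_inverse_of_pos _ (h.pos y hy)]
  simp

theorem fderiv_metric_symm (h : IsPotentialOn f G U C) {y : E} (hy : y ∈ U) (a u v : E) :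
    fderiv ℝ G y a u v = fderiv ℝ G y a v u := by
  rw [h.fderiv_metric hy, h.fderiv_metric hy, h.third_symm_right hy,
    h.third_symm_right hy a (Complex.I • u)]

theorem metric_ext (h : IsPotentialOn f G U C) {y : E} (hy : y ∈ U) {u v : E}
    (he : ∀ w, G y u w = G y v w) : u = v :=
  have : FiniteDimensional ℝ E := FiniteDimensional.complexToReal E
  ext_of_pos _ (h.pos y hy) he

theorem christoffel_symm (h : IsPotentialOn f G U C) {y : E} (hy : y ∈ U) (u v : E) :
    christoffel G y u v = christoffel G y v u := by
  refine h.metric_ext hy fun w => ?_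
  rw [h.metric_christoffel hy, h.metric_christoffel hy, h.fderiv_metric_symm hy w u v]
  ring

theorem christoffel_I_right (h : IsPotentialOn f G U C) {y : E} (hy : y ∈ U) (u v : E) :
    christoffel G y u (Complex.I • v) = Complex.I • christoffel G y u v := by
  refine h.metric_ext hy fun w => ?_
  rw [h.metric_I_left hy, h.metric_christoffel hy, h.metric_christoffel hy]
  simp only [h.fderiv_metric hy, I_smul_I_smul, map_neg, neg_apply]
  rw [h.third_symm_left hy w u, h.third_symm_right hy u w,
    h.third_symm_left hy w (Complex.I • u) v, h.third_symm_right hy _ w v,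
    h.third_symm_left hy (Complex.I • v) u w, h.third_symm_left hy (Complex.I • v) _ _,
    h.third_symm_left hy (Complex.I • w) u v, h.third_symm_right hy u _ v,
    h.third_symm_left hy (Complex.I • w) _ _, h.third_symm_right hy _ _ (Complex.I • v),
    h.third_symm_left hy v u, h.third_symm_left hy v (Complex.I • u)]
  ring

theorem christoffel_I_left (h : IsPotentialOn f G U C) {y : E} (hy : y ∈ U) (u v : E) :
    christoffel G y (Complex.I • u) v = Complex.I • christoffel G y u v := by
  rw [h.christoffel_symm hy, h.christoffel_I_right hy, h.christoffel_symm hy]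

theorem christoffel_add_right (h : IsPotentialOn f G U C) {y : E} (hy : y ∈ U) (u v w : E) :
    christoffel G y u (v + w) = christoffel G y u v + christoffel G y u w := by
  refine h.metric_ext hy fun w => ?_
  simp only [map_add, add_apply, h.metric_christoffel hy]
  ring

theorem christoffel_smul_right (h : IsPotentialOn f G U C) {y : E} (hy : y ∈ U) (u v : E) (r : ℝ) :
    christoffel G y u (r • v) = r • christoffel G y u v := by
  refine h.metric_ext hy fun w => ?_
  simp only [map_smul, smul_apply, h.metric_christoffel hy, smul_eq_mul]
  ring

theorem christoffel_add_left (h : IsPotentialOn f G U C) {y : E} (hy : y ∈ U) (u v w : E) :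
    christoffel G y (u + v) w = christoffel G y u w + christoffel G y v w := by
  simp only [h.christoffel_symm hy _ w, h.christoffel_add_right hy]

theorem christoffel_smul_left (h : IsPotentialOn f G U C) {y : E} (hy : y ∈ U) (u v : E) (r : ℝ) :
    christoffel G y (r • u) v = r • christoffel G y u v := by
  simp only [h.christoffel_symm hy _ v, h.christoffel_smul_right hy]

theorem metric_localGrad (h : IsPotentialOn f G U C) {y : E} (hy : y ∈ U) (w : E) :
    G y (localGrad f G y) w = fderiv ℝ f y w := by
  have : FiniteDimensional ℝ E := FiniteDimensional.complexToReal E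
  rw [localGrad, apply_inverse_of_pos _ (h.pos y hy)]

theorem fderiv_metric_localGrad (h : IsPotentialOn f G U C) {y : E} (hy : y ∈ U) (v w : E) :
    fderiv ℝ G y v (localGrad f G y) w + G y (fderiv ℝ (localGrad f G) y v) w =
      fderiv ℝ (fderiv ℝ f) y v w := by
  have hd : DifferentiableAt ℝ (fderiv ℝ f) y :=
    (h.contDiffOn_fderiv.contDiffAt (h.isOpen.mem_nhds hy)).differentiableAt (by simp)
  have h1 := (((h.differentiableAt_metric hy).hasFDerivAt.clm_apply
    (h.differentiableAt_localGrad hy).hasFDerivAt).clm_apply (hasFDerivAt_const w y)).fderiv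
  have he : (fun x => G x (localGrad f G x) w) =ᶠ[𝓝 y] fun x => fderiv ℝ f x w := by
    filter_upwards [h.isOpen.mem_nhds hy] with x hx using h.metric_localGrad hx w
  rw [he.fderiv_eq, (hd.hasFDerivAt.clm_apply (hasFDerivAt_const w y)).fderiv] at h1
  have h2 := DFunLike.congr_fun h1 v
  simp at h2
  linarith

theorem metric_covGrad (h : IsPotentialOn f G U C) {y : E} (hy : y ∈ U) (v w : E) :
    G y (covGrad f G y v) w = fderiv ℝ (fderiv ℝ f) y v w -
      fderiv ℝ f y (christoffel G y v w) := by
  rw [← h.fderiv_metric_localGrad hy, ← h.metric_localGrad hy, h.metric_symm hy _ (christoffel _ _ _ _),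
    h.metric_christoffel hy, covGrad, map_add, add_apply,
    h.metric_christoffel hy, h.fderiv_metric_symm hy v (localGrad f G y) w]
  ring

theorem metric_covGrad_symm (h : IsPotentialOn f G U C) {y : E} (hy : y ∈ U) (v w : E) :
    G y (covGrad f G y v) w = G y (covGrad f G y w) v := by
  rw [h.metric_covGrad hy, h.metric_covGrad hy, h.hessian_symm hy, h.christoffel_symm hy]

theorem metric_covGrad_I_I (h : IsPotentialOn f G U C) {y : E} (hy : y ∈ U) (v w : E) :
    G y (covGrad f G y (Complex.I • v)) (Complex.I • w) =
      2 * G y v w - G y (covGrad f G y v) w := by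
  rw [h.metric_covGrad hy, h.metric_covGrad hy, h.christoffel_I_left hy, h.christoffel_I_right hy,
    I_smul_I_smul, ← h.hessian y hy, map_neg]
  ring

theorem metric_covGrad_localGrad (h : IsPotentialOn f G U C) {y : E} (hy : y ∈ U) (v : E) :
    G y (covGrad f G y v) (localGrad f G y) = 0 := by
  have hg := (h.differentiableAt_localGrad hy).hasFDerivAt
  have h1 := (((h.differentiableAt_metric hy).hasFDerivAt.clm_apply hg).clm_apply hg).fderiv
  have he : (fun x => G x (localGrad f G x) (localGrad f G x)) =ᶠ[𝓝 y] fun _ => 2 * C := by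
    filter_upwards [h.isOpen.mem_nhds hy] with x hx using h.length x hx
  rw [he.fderiv_eq] at h1
  have h2 := DFunLike.congr_fun h1 v
  simp at h2
  rw [covGrad, map_add, add_apply, h.metric_christoffel hy]
  rw [h.metric_symm hy (localGrad f G y)] at h2
  rw [h.fderiv_metric_symm hy (localGrad f G y) v]
  linarith

theorem covGrad_localGrad (h : IsPotentialOn f G U C) {y : E} (hy : y ∈ U) :
    covGrad f G y (localGrad f G y) = 0 := by
  refine h.metric_ext hy fun w => ?_
  rw [h.metric_covGrad_symm hy, h.metric_covGrad_localGrad hy]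
  simp

theorem covGrad_I_localGrad (h : IsPotentialOn f G U C) {y : E} (hy : y ∈ U) :
    covGrad f G y (Complex.I • localGrad f G y) = (2 : ℝ) • Complex.I • localGrad f G y := by
  refine h.metric_ext hy fun w => ?_
  have h1 := h.metric_covGrad_I_I hy (localGrad f G y) (-(Complex.I • w))
  rw [smul_neg, I_smul_I_smul, neg_neg, h.covGrad_localGrad hy] at h1
  rw [h1, map_smul, smul_apply, h.metric_I_left hy]
  simp

theorem covGrad_add (h : IsPotentialOn f G U C) {y : E} (hy : y ∈ U) (u v : E) :
    covGrad f G y (u + v) = covGrad f G y u + covGrad f G y v := by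
  simp only [covGrad, map_add, h.christoffel_add_left hy]
  abel

theorem covGrad_smul (h : IsPotentialOn f G U C) {y : E} (hy : y ∈ U) (u : E) (r : ℝ) :
    covGrad f G y (r • u) = r • covGrad f G y u := by
  simp only [covGrad, map_smul, h.christoffel_smul_left hy, smul_add]

theorem covGrad_mem (h : IsPotentialOn f G U C) {y : E} (hy : y ∈ U) {v : E}
    (hv : v ∈ localDistribution f G y) : covGrad f G y v ∈ localDistribution f G y := by
  obtain ⟨a, b, rfl⟩ := mem_localDistribution.1 hv
  rw [h.covGrad_add hy, h.covGrad_smul hy, h.covGrad_smul hy, h.covGrad_localGrad hy,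
    h.covGrad_I_localGrad hy]
  exact mem_localDistribution.2 ⟨0, b * 2, by simp [smul_smul]⟩

theorem localGrad_ne_zero [Nontrivial E] (h : IsPotentialOn f G U C) {y : E} (hy : y ∈ U) :
    localGrad f G y ≠ 0 := by
  intro h0
  have hC : 2 * C = 0 := by
    rw [← h.length y hy]
    change G y (localGrad f G y) (localGrad f G y) = 0
    simp [h0]
  have hz : ∀ x ∈ U, localGrad f G x = 0 := fun x hx => by
    by_contra hne
    have h1 := h.pos x hx _ hne
    have h2 := h.length x hx
    rw [hC] at h2
    exact h1.ne' h2
  have hf : fderiv ℝ f =ᶠ[𝓝 y] fun _ => 0 := by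
    filter_upwards [h.isOpen.mem_nhds hy] with x hx
    ext w
    rw [← h.metric_localGrad hx, hz x hx]
    simp
  obtain ⟨u, hu⟩ := exists_ne (0 : E)
  have h1 := h.pos y hy u hu
  rw [h.metric_eq hy, hf.fderiv_eq] at h1
  simp at h1

theorem length_pos [Nontrivial E] (h : IsPotentialOn f G U C) {y : E} (hy : y ∈ U) : 0 < C := by
  have h1 := h.pos y hy _ (h.localGrad_ne_zero hy)
  have h2 := h.length y hy
  change G y (localGrad f G y) (localGrad f G y) = _ at h2
  linarith

/-- The distribution spanned by `ξ` and `√-1 ξ` is parallel along its own directions: if `Y` is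
a section of it along a map `F`, then the covariant derivative of `Y` in a direction tangent to
the distribution is a section. -/
theorem covDeriv_mem [Nontrivial E] (h : IsPotentialOn f G U C)
    {M : Type*} [NormedAddCommGroup M] [NormedSpace ℝ M] {F : M → E} {Y : M → E} {z a : M}
    (hF : DifferentiableAt ℝ F z) (hY : DifferentiableAt ℝ Y z) (hz : F z ∈ U)
    (hmem : ∀ᶠ x in 𝓝 z, Y x ∈ localDistribution f G (F x))
    (ha : fderiv ℝ F z a ∈ localDistribution f G (F z)) :
    fderiv ℝ Y z a + christoffel G (F z) (fderiv ℝ F z a) (Y z) ∈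
      localDistribution f G (F z) := by
  set ξ := localGrad f G with hξ
  have hC : 0 < C := h.length_pos hz
  have hU : ∀ᶠ x in 𝓝 z, F x ∈ U := hF.continuousAt (h.isOpen.mem_nhds hz)
  let α : M → ℝ := fun x => (2 * C)⁻¹ * G (F x) (Y x) (ξ (F x))
  let β : M → ℝ := fun x => (2 * C)⁻¹ * G (F x) (Y x) (Complex.I • ξ (F x))
  have hξF : DifferentiableAt ℝ (fun x => ξ (F x)) z :=
    (h.differentiableAt_localGrad hz).comp z hF
  have hGF : DifferentiableAt ℝ (fun x => G (F x)) z :=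
    DifferentiableAt.comp (g := G) z (h.differentiableAt_metric hz) hF
  have hIξF : DifferentiableAt ℝ (fun x => Complex.I • ξ (F x)) z := hξF.const_smul Complex.I
  have hα : DifferentiableAt ℝ α z := ((hGF.clm_apply hY).clm_apply hξF).const_mul _
  have hβ : DifferentiableAt ℝ β z := ((hGF.clm_apply hY).clm_apply hIξF).const_mul _
  have hYe : Y =ᶠ[𝓝 z] fun x => α x • ξ (F x) + β x • Complex.I • ξ (F x) := by
    filter_upwards [hU, hmem] with x hx hm
    obtain ⟨a, b, hab⟩ := mem_localDistribution.1 hm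
    have hl : G (F x) (ξ (F x)) (ξ (F x)) = 2 * C := h.length _ hx
    have h1 : α x = a := by
      simp only [α, ← hab, map_add, add_apply, map_smul,
        smul_apply, smul_eq_mul, ← hξ]
      rw [h.metric_symm hx (Complex.I • _), h.metric_self_I hx, hl]
      field_simp
      ring
    have h2 : β x = b := by
      simp only [β, ← hab, map_add, add_apply, map_smul,
        smul_apply, smul_eq_mul, ← hξ]
      rw [h.metric_I_I hx, h.metric_self_I hx, hl]
      field_simp
      ring
    rw [h1, h2, hab]
  have hξF' : HasFDerivAt (fun x => ξ (F x)) ((fderiv ℝ ξ (F z)).comp (fderiv ℝ F z)) z :=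
    (h.differentiableAt_localGrad hz).hasFDerivAt.comp z hF.hasFDerivAt
  have hD := (hα.hasFDerivAt.fun_smul hξF').add
    (hβ.hasFDerivAt.fun_smul (hξF'.const_smul Complex.I))
  have hYz := hYe.eq_of_nhds
  have hfd : fderiv ℝ Y z a = _ := DFunLike.congr_fun (hYe.fderiv_eq.trans hD.fderiv) a
  have hcov := h.covGrad_mem hz ha
  have key : fderiv ℝ Y z a + christoffel G (F z) (fderiv ℝ F z a) (Y z) =
      fderiv ℝ α z a • ξ (F z) + fderiv ℝ β z a • Complex.I • ξ (F z) +
      (α z • covGrad f G (F z) (fderiv ℝ F z a) +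
        β z • Complex.I • covGrad f G (F z) (fderiv ℝ F z a)) := by
    rw [hfd, hYz, h.christoffel_add_right hz, h.christoffel_smul_right hz,
      h.christoffel_smul_right hz, h.christoffel_I_right hz, covGrad]
    simp only [add_apply, smul_apply,
      ContinuousLinearMap.smulRight_apply, ContinuousLinearMap.comp_apply, smul_add, Pi.smul_apply,
      ← hξ]
    abel
  rw [key]
  refine Submodule.add_mem _ (mem_localDistribution.2 ⟨_, _, rfl⟩) (Submodule.add_mem _
    (Submodule.smul_mem _ _ hcov) (Submodule.smul_mem _ _ (I_smul_mem_localDistribution hcov)))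

/-- The bracket of two sections of the distribution is a section. -/
theorem lieBracket_mem [Nontrivial E] (h : IsPotentialOn f G U C) {A B : E → E} {y : E}
    (hy : y ∈ U) (hA : DifferentiableAt ℝ A y) (hB : DifferentiableAt ℝ B y)
    (hAm : ∀ᶠ x in 𝓝 y, A x ∈ localDistribution f G x)
    (hBm : ∀ᶠ x in 𝓝 y, B x ∈ localDistribution f G x) :
    VectorField.lieBracket ℝ A B y ∈ localDistribution f G y := by
  have h1 := h.covDeriv_mem (F := id) (a := A y) differentiableAt_id hB hy hBm
    (by simpa using hAm.self_of_nhds)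
  have h2 := h.covDeriv_mem (F := id) (a := B y) differentiableAt_id hA hy hAm
    (by simpa using hBm.self_of_nhds)
  have h3 := Submodule.sub_mem _ h1 h2
  simp only [fderiv_id, ContinuousLinearMap.id_apply, id] at h3
  rw [h.christoffel_symm hy (B y)] at h3
  simpa [VectorField.lieBracket] using h3

end IsPotentialOn

namespace IsPotentialOn

section Plane

variable {f : ℂ → ℝ} {G : ℂ → ℂ →L[ℝ] ℂ →L[ℝ] ℝ} {U : Set ℂ} {C : ℝ}

theorem christoffel_complex (h : IsPotentialOn f G U C) {y : ℂ} (hy : y ∈ U) (u v : ℂ) :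
    christoffel G y u v = christoffel G y 1 1 * u * v := by
  have hsm : ∀ u v c : ℂ, christoffel G y u (c * v) = c * christoffel G y u v := fun u v c => by
    have hc : c * v = c.re • v + c.im • Complex.I • v := by
      conv_lhs => rw [← Complex.re_add_im c]
      simp only [Complex.real_smul, smul_eq_mul]
      ring
    rw [hc, h.christoffel_add_right hy, h.christoffel_smul_right hy, h.christoffel_smul_right hy,
      h.christoffel_I_right hy]
    conv_rhs => rw [← Complex.re_add_im c]
    simp only [Complex.real_smul, smul_eq_mul]
    ring
  have h1 := hsm u 1 v
  have h2 := hsm 1 1 u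
  rw [mul_one] at h1 h2
  rw [h1, h.christoffel_symm hy, h2]
  ring

theorem covGrad_complex (h : IsPotentialOn f G U C) {y : ℂ} (hy : y ∈ U) (v : ℂ) :
    covGrad f G y v = v - (starRingEnd ℂ) v * (localGrad f G y / (starRingEnd ℂ) (localGrad f G y)) := by
  have hne := h.localGrad_ne_zero hy
  set ξ := localGrad f G y with hξ
  have hne' : (starRingEnd ℂ) ξ ≠ 0 := (map_ne_zero _).2 hne
  obtain ⟨c, rfl⟩ : ∃ c, v = c * ξ := ⟨v / ξ, by field_simp⟩
  have hc : c * ξ = c.re • ξ + c.im • Complex.I • ξ := by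
    conv_lhs => rw [← Complex.re_add_im c]
    simp only [Complex.real_smul, smul_eq_mul]
    ring
  rw [map_mul, mul_assoc, mul_div_cancel₀ _ hne', ← sub_mul]
  conv_lhs => rw [hc]
  rw [h.covGrad_add hy, h.covGrad_smul hy, h.covGrad_smul hy, hξ, h.covGrad_localGrad hy,
    h.covGrad_I_localGrad hy, ← hξ]
  have h2 : c - (starRingEnd ℂ) c = 2 * c.im * Complex.I := by
    rw [Complex.sub_conj]; push_cast; ring
  rw [h2]
  simp only [Complex.real_smul, smul_eq_mul]
  push_cast
  ring

theorem fderiv_localGrad_complex (h : IsPotentialOn f G U C) {y : ℂ} (hy : y ∈ U) (v : ℂ) :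
    fderiv ℝ (localGrad f G) y v =
      v - (starRingEnd ℂ) v * (localGrad f G y / (starRingEnd ℂ) (localGrad f G y)) -
        christoffel G y 1 1 * v * localGrad f G y := by
  rw [← h.covGrad_complex hy, covGrad, h.christoffel_complex hy v]
  ring

theorem differentiableAt_christoffel_one (h : IsPotentialOn f G U C) {y : ℂ} (hy : y ∈ U) :
    DifferentiableAt ℝ (fun x => christoffel G x 1 1) y := by
  have hξ := h.differentiableAt_localGrad hy
  have hξ' : DifferentiableAt ℝ (fderiv ℝ (localGrad f G)) y :=
    ((h.contDiffOn_localGrad.fderiv_of_isOpen (m := ∞) h.isOpen (by simp)).contDiffAt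
      (h.isOpen.mem_nhds hy)).differentiableAt (by simp)
  have hne := h.localGrad_ne_zero hy
  have hc : DifferentiableAt ℝ (fun x => (starRingEnd ℂ) (localGrad f G x)) y :=
    Complex.conjCLE.differentiableAt.comp y hξ
  have he : (fun x => christoffel G x 1 1) =ᶠ[𝓝 y] fun x => (1 - localGrad f G x *
      ((starRingEnd ℂ) (localGrad f G x))⁻¹ - fderiv ℝ (localGrad f G) x 1) *
        (localGrad f G x)⁻¹ := by
    filter_upwards [h.isOpen.mem_nhds hy] with x hx
    have hx0 := h.localGrad_ne_zero hx
    rw [h.fderiv_localGrad_complex hx, map_one]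
    field_simp
    ring
  refine he.differentiableAt_iff.2 ?_
  exact (((differentiableAt_const _).sub (hξ.mul (hc.inv ((map_ne_zero _).2 hne)))).sub
    (hξ'.clm_apply (differentiableAt_const _))).mul (hξ.inv hne)

/-- `∂γ/∂z̄ = 2 / |ξ|²` for the connection form `γ dz`. -/
theorem fderiv_christoffel_one (h : IsPotentialOn f G U C) {y : ℂ} (hy : y ∈ U) :
    fderiv ℝ (fun x => christoffel G x 1 1) y 1 +
      Complex.I * fderiv ℝ (fun x => christoffel G x 1 1) y Complex.I =
      4 / (localGrad f G y * (starRingEnd ℂ) (localGrad f G y)) := by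
  have hγ := (h.differentiableAt_christoffel_one hy).hasFDerivAt
  have hξ := (h.differentiableAt_localGrad hy).hasFDerivAt
  have hne := h.localGrad_ne_zero hy
  have hP := h.fderiv_localGrad_complex hy 1
  have hQ := h.fderiv_localGrad_complex hy Complex.I
  have hsym : fderiv ℝ (fderiv ℝ (localGrad f G)) y Complex.I 1 =
      fderiv ℝ (fderiv ℝ (localGrad f G)) y 1 Complex.I :=
    ((h.contDiffOn_localGrad.contDiffAt (h.isOpen.mem_nhds hy)).isSymmSndFDerivAt
      two_le_smoothness).eq _ _
  have hξ' : DifferentiableAt ℝ (fderiv ℝ (localGrad f G)) y :=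
    ((h.contDiffOn_localGrad.fderiv_of_isOpen (m := ∞) h.isOpen (by simp)).contDiffAt
      (h.isOpen.mem_nhds hy)).differentiableAt (by simp)
  have hc : HasFDerivAt (fun x => (starRingEnd ℂ) (localGrad f G x))
      ((Complex.conjCLE : ℂ →L[ℝ] ℂ).comp (fderiv ℝ (localGrad f G) y)) y :=
    Complex.conjCLE.hasFDerivAt.comp y hξ
  have hne' : (starRingEnd ℂ) (localGrad f G y) ≠ 0 := (map_ne_zero _).2 hne
  have hinv : HasFDerivAt (fun x => ((starRingEnd ℂ) (localGrad f G x))⁻¹) _ y :=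
    ((hasDerivAt_inv hne').hasFDerivAt.restrictScalars ℝ).comp y hc
  have hm := hξ.mul hinv
  have hsnd : ∀ u v : ℂ, fderiv ℝ (fderiv ℝ (localGrad f G)) y u v =
      -((starRingEnd ℂ) v * (fderiv ℝ (localGrad f G) y u / (starRingEnd ℂ) (localGrad f G y) -
          localGrad f G y * (starRingEnd ℂ) (fderiv ℝ (localGrad f G) y u) /
            (starRingEnd ℂ) (localGrad f G y) ^ 2)) -
        v * (fderiv ℝ (fun x => christoffel G x 1 1) y u * localGrad f G y +
          christoffel G y 1 1 * fderiv ℝ (localGrad f G) y u) := fun u v => by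
    have he : (fun x => fderiv ℝ (localGrad f G) x v) =ᶠ[𝓝 y] fun x =>
        v - (starRingEnd ℂ) v * (localGrad f G x * ((starRingEnd ℂ) (localGrad f G x))⁻¹) -
        v * (christoffel G x 1 1 * localGrad f G x) := by
      filter_upwards [h.isOpen.mem_nhds hy] with x hx
      rw [h.fderiv_localGrad_complex hx, div_eq_mul_inv]
      ring
    have h1 := (hξ'.hasFDerivAt.clm_apply (hasFDerivAt_const v y)).fderiv
    have h2 := (((hasFDerivAt_const v y).sub (hm.const_mul ((starRingEnd ℂ) v))).sub
      ((hγ.mul hξ).const_mul v)).fderiv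
    have h3 := DFunLike.congr_fun (h1.symm.trans (he.fderiv_eq.trans h2)) u
    simp at h3
    rw [h3]
    field_simp
    ring
  rw [hsnd, hsnd] at hsym
  have hPc := congrArg (starRingEnd ℂ) hP
  have hQc := congrArg (starRingEnd ℂ) hQ
  simp only [map_sub, map_mul, map_div₀, map_one, map_neg, Complex.conj_I, neg_neg,
    Complex.conj_conj] at hPc hQc
  simp only [map_one, Complex.conj_I] at hsym hP hQ
  rw [hPc, hQc, hP, hQ] at hsym
  generalize fderiv ℝ (fun x => christoffel G x 1 1) y 1 = a at *
  generalize fderiv ℝ (fun x => christoffel G x 1 1) y Complex.I = b at *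
  generalize localGrad f G y = ξ at *
  generalize (starRingEnd ℂ) ξ = η at *
  generalize christoffel G y 1 1 = γ at *
  have hI := Complex.I_mul_I
  generalize Complex.I = i at *
  rw [eq_div_iff (mul_ne_zero hne hne')]
  clear hPc hQc hP hQ hsnd hm hinv
  field_simp at hsym
  refine mul_left_cancel₀ hne' ?_
  linear_combination (-i) * hsym + (η ^ 2 * a * ξ - 4 * η) * hI

theorem gaussianCurvature_eq (h : IsPotentialOn f G U C) {y : ℂ} (hy : y ∈ U) :
    gaussianCurvature G y = -2 / C := by
  have hγ := (h.differentiableAt_christoffel_one hy).hasFDerivAt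
  have hne := h.localGrad_ne_zero hy
  have hl := h.length y hy
  have hC := h.length_pos hy
  change G y (localGrad f G y) (localGrad f G y) = _ at hl
  have hconf : ∀ c : ℂ, G y c c = Complex.normSq c * G y 1 1 := fun c => by
    have hc : c = c.re • 1 + c.im • Complex.I • 1 := by
      conv_lhs => rw [← Complex.re_add_im c]
      simp only [Complex.real_smul, smul_eq_mul]
      ring
    conv_lhs => rw [hc]
    simp only [map_add, map_smul, add_apply, smul_apply]
    rw [h.metric_I_I hy, h.metric_symm hy (Complex.I • 1), h.metric_self_I hy, Complex.normSq_apply]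
    simp only [smul_eq_mul]
    ring
  have hR : curvature G y 1 Complex.I Complex.I =
      ((-4 / Complex.normSq (localGrad f G y) : ℝ) : ℂ) := by
    have h1 : fderiv ℝ (fun x => christoffel G x Complex.I Complex.I) y 1 =
        - fderiv ℝ (fun x => christoffel G x 1 1) y 1 := by
      have he : (fun x => christoffel G x Complex.I Complex.I) =ᶠ[𝓝 y]
          fun x => - christoffel G x 1 1 := by
        filter_upwards [h.isOpen.mem_nhds hy] with x hx
        rw [h.christoffel_complex hx, mul_assoc, Complex.I_mul_I]
        ring
      rw [he.fderiv_eq, hγ.fun_neg.fderiv]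
      rfl
    have h2 : fderiv ℝ (fun x => christoffel G x 1 Complex.I) y Complex.I =
        Complex.I * fderiv ℝ (fun x => christoffel G x 1 1) y Complex.I := by
      have he : (fun x => christoffel G x 1 Complex.I) =ᶠ[𝓝 y]
          fun x => Complex.I * christoffel G x 1 1 := by
        filter_upwards [h.isOpen.mem_nhds hy] with x hx
        rw [h.christoffel_complex hx 1 Complex.I]
        ring
      rw [he.fderiv_eq, (hγ.const_mul Complex.I).fderiv]
      rfl
    have h3 := h.fderiv_christoffel_one hy
    rw [Complex.mul_conj] at h3
    rw [curvature, h1, h2, h.christoffel_complex hy 1 (christoffel _ _ _ _),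
      h.christoffel_complex hy Complex.I (christoffel _ _ _ _), h.christoffel_complex hy 1 Complex.I,
      h.christoffel_complex hy Complex.I Complex.I]
    push_cast
    rw [neg_div, ← h3]
    ring
  have hR' : curvature G y 1 Complex.I Complex.I =
      (-4 / Complex.normSq (localGrad f G y)) • (1 : ℂ) := by
    rw [hR, Complex.real_smul, mul_one]
  have h0 : G y 1 Complex.I = 0 := by simpa using h.metric_self_I hy 1
  have h1 : G y Complex.I Complex.I = G y 1 1 := by simpa using h.metric_I_I hy 1 1
  have hp : 0 < G y 1 1 := h.pos y hy 1 one_ne_zero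
  have hn : 0 < Complex.normSq (localGrad f G y) := Complex.normSq_pos.2 hne
  rw [hconf] at hl
  rw [gaussianCurvature, sectionalCurvature, hR', h0, h1, map_smul, smul_apply, smul_eq_mul]
  have hC' : C = Complex.normSq (localGrad f G y) * G y 1 1 / 2 := by linarith
  rw [hC']
  field_simp
  norm_num
  ring

end Plane

section Curve

variable {E : Type*} [NormedAddCommGroup E] [NormedSpace ℂ E] [FiniteDimensional ℂ E]
  {f : E → ℝ} {G : E → E →L[ℝ] E →L[ℝ] ℝ} {U : Set E} {C : ℝ}

/-- The restriction of a potential to a holomorphic curve tangent to the distribution. -/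
theorem comp_holomorphic (h : IsPotentialOn f G U C) {F : ℂ → E} {W : Set ℂ} (hW : IsOpen W)
    (hF : DifferentiableOn ℂ F W) (hFU : ∀ w ∈ W, F w ∈ U) (hF0 : ∀ w ∈ W, deriv F w ≠ 0)
    (hFD : ∀ w ∈ W, deriv F w ∈ localDistribution f G (F w)) :
    IsPotentialOn (f ∘ F)
      (fun w => (G (F w)).bilinearComp (fderiv ℝ F w) (fderiv ℝ F w)) W C := by
  have : CompleteSpace E := FiniteDimensional.complete ℂ E
  have hFC : ContDiffOn ℝ ∞ F W := (hF.contDiffOn hW).restrict_scalars ℝ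
  have hF1 : ∀ w ∈ W, ∀ u, fderiv ℝ F w u = u • deriv F w := fun w hw u => by
    have h1 := (hF.differentiableAt (hW.mem_nhds hw)).hasDerivAt.hasFDerivAt.restrictScalars ℝ
    rw [h1.fderiv]
    simp
  have hF2 : DifferentiableOn ℂ (deriv F) W := hF.deriv hW
  have hpos : ∀ w ∈ W, ∀ u, u ≠ 0 →
      0 < (G (F w)).bilinearComp (fderiv ℝ F w) (fderiv ℝ F w) u u := fun w hw u hu => by
    rw [ContinuousLinearMap.bilinearComp_apply, hF1 w hw]
    exact h.pos _ (hFU w hw) _ (smul_ne_zero hu (hF0 w hw))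
  have hfF : ∀ w ∈ W, fderiv ℝ (f ∘ F) w = (fderiv ℝ f (F w)).comp (fderiv ℝ F w) := fun w hw =>
    fderiv_comp w ((h.smooth.contDiffAt (h.isOpen.mem_nhds (hFU w hw))).differentiableAt (by simp))
      ((hFC.contDiffAt (hW.mem_nhds hw)).differentiableAt (by simp))
  have hsmooth : ContDiffOn ℝ ∞ (f ∘ F) W := h.smooth.comp hFC hFU
  refine ⟨hW, hsmooth, fun w hw u v => ?_, hpos, fun w hw => ?_⟩
  · have hdd : DifferentiableAt ℝ (fderiv ℝ (f ∘ F)) w :=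
      ((hsmooth.fderiv_of_isOpen (m := ∞) hW (by simp)).contDiffAt
        (hW.mem_nhds hw)).differentiableAt (by simp)
    have hfd : HasFDerivAt (fderiv ℝ f) (fderiv ℝ (fderiv ℝ f) (F w)) (F w) :=
      ((h.contDiffOn_fderiv.contDiffAt
        (h.isOpen.mem_nhds (hFU w hw))).differentiableAt (by simp)).hasFDerivAt
    have hF' : HasFDerivAt F (fderiv ℝ F w) w :=
      ((hFC.contDiffAt (hW.mem_nhds hw)).differentiableAt (by simp)).hasFDerivAt
    have hdF : HasFDerivAt (deriv F) (fderiv ℝ (deriv F) w) w :=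
      ((hF2.differentiableAt (hW.mem_nhds hw)).restrictScalars ℝ).hasFDerivAt
    have hdF1 : ∀ u, fderiv ℝ (deriv F) w u = u • deriv (deriv F) w := fun u => by
      rw [((hF2.differentiableAt
        (hW.mem_nhds hw)).hasDerivAt.hasFDerivAt.restrictScalars ℝ).fderiv]
      simp
    have key : ∀ u v : ℂ, fderiv ℝ (fderiv ℝ (f ∘ F)) w u v =
        fderiv ℝ (fderiv ℝ f) (F w) (fderiv ℝ F w u) (fderiv ℝ F w v) +
          fderiv ℝ f (F w) ((v * u) • deriv (deriv F) w) := fun u v => by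
      have h1 := (hdd.hasFDerivAt.clm_apply (hasFDerivAt_const v w)).fderiv
      have he : (fun x => fderiv ℝ (f ∘ F) x v) =ᶠ[𝓝 w] fun x =>
          fderiv ℝ f (F x) (v • deriv F x) := by
        filter_upwards [hW.mem_nhds hw] with x hx
        rw [hfF x hx, ContinuousLinearMap.comp_apply, hF1 x hx]
      have h2 := ((hfd.comp w hF').clm_apply (hdF.const_smul v)).fderiv
      have h3 := DFunLike.congr_fun (h1.symm.trans (he.fderiv_eq.trans h2)) u
      simp only [ContinuousLinearMap.comp_zero, zero_add, ContinuousLinearMap.flip_apply, add_apply,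
        ContinuousLinearMap.comp_apply, smul_apply, Function.comp_apply, hdF1, Pi.smul_apply] at h3
      rw [h3, hF1 w hw v, mul_smul, add_comm]
    rw [key, key, ContinuousLinearMap.bilinearComp_apply, ← h.hessian _ (hFU w hw)]
    have hI : ∀ u, fderiv ℝ F w (Complex.I • u) = Complex.I • fderiv ℝ F w u := fun u => by
      rw [hF1 w hw, hF1 w hw, smul_smul, smul_eq_mul]
    have hz : (Complex.I • v * Complex.I • u : ℂ) = - (v * u) := by
      simp only [smul_eq_mul]
      linear_combination (v * u) * Complex.I_mul_I
    rw [hI, hI, hz, neg_smul, map_neg]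
    ring
  · obtain ⟨a, b, hab⟩ := mem_localDistribution.1 (hFD w hw)
    set ξ := localGrad f G (F w) with hξ
    obtain ⟨c, hc⟩ : ∃ c : ℂ, deriv F w = c • ξ := by
      refine ⟨a + b * Complex.I, ?_⟩
      rw [← hab, add_smul, mul_smul, Complex.coe_smul, Complex.coe_smul]
    have hc0 : c ≠ 0 := by
      rintro rfl
      exact hF0 w hw (by rw [hc, zero_smul])
    have hDF : fderiv ℝ F w c⁻¹ = ξ := by
      rw [hF1 w hw, hc, smul_smul, inv_mul_cancel₀ hc0, one_smul]
    have hgrad : ((G (F w)).bilinearComp (fderiv ℝ F w) (fderiv ℝ F w)).inverse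
        (fderiv ℝ (f ∘ F) w) = c⁻¹ := by
      refine ext_of_pos _ (hpos w hw) fun v => ?_
      rw [apply_inverse_of_pos _ (hpos w hw), hfF w hw, ContinuousLinearMap.comp_apply,
        ContinuousLinearMap.bilinearComp_apply, hDF, h.metric_localGrad (hFU w hw)]
    rw [hgrad, ContinuousLinearMap.bilinearComp_apply, hDF]
    exact h.length _ (hFU w hw)

end Curve

end IsPotentialOn

theorem christoffel_congr {F : Type*} [NormedAddCommGroup F] [NormedSpace ℝ F]
    {G G' : F → F →L[ℝ] F →L[ℝ] ℝ} {y : F} (h : G =ᶠ[𝓝 y] G') (u v : F) :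
    christoffel G y u v = christoffel G' y u v := by
  rw [christoffel, christoffel, h.eq_of_nhds, h.fderiv_eq]

theorem gaussianCurvature_congr {G G' : ℂ → ℂ →L[ℝ] ℂ →L[ℝ] ℝ} {y : ℂ} (h : G =ᶠ[𝓝 y] G') :
    gaussianCurvature G y = gaussianCurvature G' y := by
  have he : ∀ u v : ℂ, (fun x => christoffel G x u v) =ᶠ[𝓝 y] fun x => christoffel G' x u v :=
    fun u v => h.eventually_nhds.mono fun x hx => christoffel_congr hx u v
  simp only [gaussianCurvature, sectionalCurvature, curvature, (he _ _).fderiv_eq,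
    christoffel_congr h, h.eq_of_nhds]

section RestrictScalars

variable {E : Type*} [NormedAddCommGroup E] [NormedSpace ℂ E]
  {E' : Type*} [NormedAddCommGroup E'] [NormedSpace ℂ E']
  {X : Type*} [TopologicalSpace X] [ChartedSpace E X]
  {X' : Type*} [TopologicalSpace X'] [ChartedSpace E' X']

theorem hasMFDerivAt_restrictScalars {f : X → X'} {x : X} {f' : E →L[ℂ] E'}
    (h : HasMFDerivAt 𝓘(ℂ, E) 𝓘(ℂ, E') f x f') :
    HasMFDerivAt 𝓘(ℝ, E) 𝓘(ℝ, E') f x (f'.restrictScalars ℝ : E →L[ℝ] E') := by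
  refine ⟨h.1, ?_⟩
  have h2 : HasFDerivWithinAt (writtenInExtChartAt 𝓘(ℂ, E) 𝓘(ℂ, E') x f) f'
    (Set.range 𝓘(ℂ, E)) (extChartAt 𝓘(ℂ, E) x x) := h.2
  exact h2.restrictScalars ℝ

/-- The real differential, as a linear map between the model spaces. -/
def realDeriv {F F' : Type*} [NormedAddCommGroup F] [NormedSpace ℝ F] [NormedAddCommGroup F']
    [NormedSpace ℝ F'] {M M' : Type*} [TopologicalSpace M] [ChartedSpace F M]
    [TopologicalSpace M'] [ChartedSpace F' M'] (f : M → M') (x : M) : F →L[ℝ] F' :=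
  mfderiv 𝓘(ℝ, F) 𝓘(ℝ, F') f x

/-- The real differential of a holomorphic map commutes with the complex structures. -/
theorem realDeriv_I_smul {f : X → X'} {x : X}
    (h : MDifferentiableAt 𝓘(ℂ, E) 𝓘(ℂ, E') f x) (u : E) :
    (realDeriv f x : E →L[ℝ] E') (Complex.I • u) = Complex.I • (realDeriv f x : E →L[ℝ] E') u := by
  have h1 := (hasMFDerivAt_restrictScalars h.hasMFDerivAt).mfderiv
  have h2 : (realDeriv f x : E →L[ℝ] E') =
    (mfderiv 𝓘(ℂ, E) 𝓘(ℂ, E') f x : E →L[ℂ] E').restrictScalars ℝ := h1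
  rw [h2]
  exact map_smul (mfderiv 𝓘(ℂ, E) 𝓘(ℂ, E') f x : E →L[ℂ] E') _ _

end RestrictScalars

section Chart

variable {E : Type*} [NormedAddCommGroup E] [NormedSpace ℂ E] [FiniteDimensional ℂ E]
  {X : Type*} [TopologicalSpace X] [ChartedSpace E X] [IsManifold 𝓘(ℂ, E) ω X]
  (K : KahlerMetric E X) {V : Set X} {φ : X → ℝ} {C : ℝ} {c : OpenPartialHomeomorph X E}

/-- The differential of the inverse of a chart. -/
def chartDeriv (c : OpenPartialHomeomorph X E) (y : E) : E →L[ℝ] E :=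
  realDeriv c.symm y

theorem chartDeriv_I_smul (hc : c ∈ atlas E X) {y : E} (hy : y ∈ c.target) (u : E) :
    chartDeriv c y (Complex.I • u) = Complex.I • chartDeriv c y u :=
  realDeriv_I_smul (mdifferentiableAt_atlas_symm hc hy) u

theorem chartDeriv_bijective (hc : c ∈ atlas E X) {y : E} (hy : y ∈ c.target) :
    Function.Bijective (chartDeriv c y) :=
  (mdifferentiable_of_mem_atlas (I := 𝓘(ℝ, E)) hc).symm.mfderiv_bijective hy

/-- The metric on a tangent space, as a bilinear form on the model space. -/
def metricAt (p : X) : E →L[ℝ] E →L[ℝ] ℝ := K.inner p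

theorem metricAt_pos (p : X) (u : E) (hu : u ≠ 0) : 0 < metricAt K p u u := K.pos p u hu

theorem pullback_chart_apply (y u v : E) : pullback K.inner c.symm y u v =
    metricAt K (c.symm y) (chartDeriv c y u) (chartDeriv c y v) := rfl

/-- The gradient, as a vector of the model space. -/
def gradAt (φ : X → ℝ) (p : X) : E := K.grad φ p

theorem metricAt_grad (p : X) (w : E) :
    metricAt K p (gradAt K φ p) w = (dReal φ p : E →L[ℝ] ℝ) w := by
  have : FiniteDimensional ℝ E := FiniteDimensional.complexToReal E
  exact DFunLike.congr_fun (apply_inverse_of_pos (metricAt K p) (metricAt_pos K p) (dReal φ p)) w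

theorem metricAt_grad_grad (p : X) :
    metricAt K p (gradAt K φ p) (gradAt K φ p) = 2 * K.gradLengthSq φ p := by
  have h : K.gradLengthSq φ p = metricAt K p (gradAt K φ p) (gradAt K φ p) / 2 := by
    simp [KahlerMetric.gradLengthSq, KahlerMetric.herm, metricAt, gradAt]
    rfl
  rw [h]
  ring

theorem pullback_chart_pos (hc : c ∈ atlas E X) {y : E} (hy : y ∈ c.target) (u : E) (hu : u ≠ 0) :
    0 < pullback K.inner c.symm y u u := by
  rw [pullback_chart_apply]
  refine metricAt_pos K _ _ fun h0 => hu ((chartDeriv_bijective hc hy).1 ?_)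
  rw [h0, map_zero]

theorem mdifferentiableAt_of_potential (hφ : K.IsLocalPotential φ V) {p : X} (hp : p ∈ V) :
    MDifferentiableAt 𝓘(ℝ, E) 𝓘(ℝ, ℝ) φ p :=
  (hφ.smooth.contMDiffAt (hφ.isOpen.mem_nhds hp)).mdifferentiableAt (by simp)

theorem fderiv_chart (hφ : K.IsLocalPotential φ V) (hc : c ∈ atlas E X) {y : E}
    (hy : y ∈ c.target) (hyV : c.symm y ∈ V) (u : E) :
    fderiv ℝ (φ ∘ c.symm) y u = (dReal φ (c.symm y) : E →L[ℝ] ℝ) (chartDeriv c y u) := by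
  have h := mfderiv_comp y (mdifferentiableAt_of_potential K hφ hyV)
    (mdifferentiableAt_atlas_symm (I := 𝓘(ℝ, E)) hc hy)
  rw [mfderiv_eq_fderiv] at h
  exact DFunLike.congr_fun h u

theorem chartDeriv_localGrad (hφ : K.IsLocalPotential φ V) (hc : c ∈ atlas E X) {y : E}
    (hy : y ∈ c.target) (hyV : c.symm y ∈ V) :
    chartDeriv c y (localGrad (φ ∘ c.symm) (pullback K.inner c.symm) y) = gradAt K φ (c.symm y) := by
  have : FiniteDimensional ℝ E := FiniteDimensional.complexToReal E
  refine ext_of_pos _ (metricAt_pos K (c.symm y)) fun w => ?_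
  obtain ⟨u, rfl⟩ := (chartDeriv_bijective hc hy).2 w
  rw [← pullback_chart_apply, localGrad, apply_inverse_of_pos _ (pullback_chart_pos K hc hy),
    metricAt_grad, fderiv_chart K hφ hc hy hyV]

theorem isPotentialOn_chart (hφ : K.IsLocalPotential φ V) (hC : ∀ p ∈ V, K.gradLengthSq φ p = C)
    (hc : c ∈ atlas E X) :
    IsPotentialOn (φ ∘ c.symm) (pullback K.inner c.symm) (c.target ∩ c.symm ⁻¹' V) C where
  isOpen := c.isOpen_inter_preimage_symm hφ.isOpen
  smooth := by
    have h1 : ContMDiffOn 𝓘(ℝ, E) 𝓘(ℝ, E) ∞ c.symm c.target :=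
      contMDiffOn_symm_of_mem_maximalAtlas (IsManifold.subset_maximalAtlas hc)
    exact contMDiffOn_iff_contDiffOn.1
      (hφ.smooth.comp (h1.mono Set.inter_subset_left) fun y hy => hy.2)
  hessian y hy u v := by
    have h := congrArg Complex.re (hφ.complexHessian_eq c hc y hy.1 hy.2 u v)
    have h2 : (fderiv ℝ (fderiv ℝ (φ ∘ c.symm)) y u v + fderiv ℝ (fderiv ℝ (φ ∘ c.symm)) y
        (Complex.I • u) (Complex.I • v)) / 4 = pullback K.inner c.symm y u v / 2 := by
      simpa [complexHessian, KahlerMetric.herm] using! h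
    linarith
  pos y hy := pullback_chart_pos K hc hy.1
  length y hy := by
    change pullback K.inner c.symm y (localGrad _ _ y) (localGrad _ _ y) = _
    rw [pullback_chart_apply, chartDeriv_localGrad K hφ hc hy.1 hy.2]
    exact (metricAt_grad_grad K _).trans (by rw [hC _ hy.2])

/-- The distribution, as a subspace of the model space. -/
def distAt (φ : X → ℝ) (p : X) : Submodule ℝ E :=
  Submodule.span ℝ {gradAt K φ p, Complex.I • gradAt K φ p}

/-- The distribution in a chart. -/
theorem chartDeriv_mem_iff (hφ : K.IsLocalPotential φ V) (hc : c ∈ atlas E X) {y : E}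
    (hy : y ∈ c.target) (hyV : c.symm y ∈ V) (u : E) :
    chartDeriv c y u ∈ distAt K φ (c.symm y) ↔
      u ∈ localDistribution (φ ∘ c.symm) (pullback K.inner c.symm) y := by
  have hg := chartDeriv_localGrad K hφ hc hy hyV
  rw [distAt, ← hg, ← chartDeriv_I_smul hc hy, mem_localDistribution, Submodule.mem_span_pair]
  simp only [← map_smul, ← map_add, (chartDeriv_bijective hc hy).1.eq_iff]

theorem grad_ne_zero [Nontrivial E] (hφ : K.IsLocalPotential φ V)
    (hC : ∀ p ∈ V, K.gradLengthSq φ p = C) {p : X} (hp : p ∈ V) : gradAt K φ p ≠ 0 := by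
  have hc := chart_mem_atlas E p
  have ht := mem_chart_target E p
  have hs := (chartAt E p).left_inv (mem_chart_source E p)
  have h := (isPotentialOn_chart K hφ hC hc).localGrad_ne_zero ⟨ht, by simpa [hs] using hp⟩
  have hg := chartDeriv_localGrad K hφ hc ht (by rwa [hs])
  rw [hs] at hg
  intro h0
  refine h ((chartDeriv_bijective hc ht).1 ?_)
  rw [map_zero, hg, h0]

theorem length_pos [Nontrivial E] (hφ : K.IsLocalPotential φ V)
    (hC : ∀ p ∈ V, K.gradLengthSq φ p = C) (hV : V.Nonempty) : 0 < C := by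
  obtain ⟨p, hp⟩ := hV
  have h1 := metricAt_pos K p _ (grad_ne_zero K hφ hC hp)
  have h2 := (metricAt_grad_grad K p).trans (by rw [hC p hp])
  linarith

theorem finrank_gradDistribution [Nontrivial E] (hφ : K.IsLocalPotential φ V)
    (hC : ∀ p ∈ V, K.gradLengthSq φ p = C) {p : X} (hp : p ∈ V) :
    Module.finrank ℝ (K.gradDistribution φ p) = 2 := by
  have h0 := grad_ne_zero K hφ hC hp
  have hli : LinearIndependent ℝ ![gradAt K φ p, Complex.I • gradAt K φ p] := by
    rw [LinearIndependent.pair_iff]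
    intro a b hab
    have h1 : ((a : ℂ) + b * Complex.I) • gradAt K φ p = 0 := by
      rw [← hab, add_smul, mul_smul, Complex.coe_smul, Complex.coe_smul]
    have h2 := (smul_eq_zero.1 h1).resolve_right h0
    exact ⟨by simpa using congrArg Complex.re h2, by simpa using congrArg Complex.im h2⟩
  have h := finrank_span_eq_card hli
  rw [Matrix.range_cons, Matrix.range_cons, Matrix.range_empty, Set.union_empty,
    Set.singleton_union] at h
  exact h

/-- A section of the distribution, read in a chart. -/
def chartSection (c : OpenPartialHomeomorph X E) (A : ∀ p : X, TangentSpace 𝓘(ℝ, E) p)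
    (y : E) : E :=
  (chartDeriv c y).inverse (A (c.symm y))

theorem chartDeriv_chartSection (hc : c ∈ atlas E X) {y : E} (hy : y ∈ c.target)
    (A : ∀ p : X, TangentSpace 𝓘(ℝ, E) p) :
    chartDeriv c y (chartSection c A y) = A (c.symm y) := by
  have : FiniteDimensional ℝ E := FiniteDimensional.complexToReal E
  let L := (LinearEquiv.ofBijective (chartDeriv c y : E →ₗ[ℝ] E)
    (chartDeriv_bijective hc hy)).toContinuousLinearEquiv
  have hL : (L : E →L[ℝ] E) = chartDeriv c y := by ext; rfl
  rw [chartSection, ← hL, ContinuousLinearMap.inverse_equiv]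
  exact L.apply_symm_apply _

theorem chartSection_mem (hφ : K.IsLocalPotential φ V) (hc : c ∈ atlas E X) {y : E}
    (hy : y ∈ c.target) (hyV : c.symm y ∈ V) {A : ∀ p : X, TangentSpace 𝓘(ℝ, E) p}
    (hA : A (c.symm y) ∈ K.gradDistribution φ (c.symm y)) :
    chartSection c A y ∈ localDistribution (φ ∘ c.symm) (pullback K.inner c.symm) y := by
  rw [← chartDeriv_mem_iff K hφ hc hy hyV, chartDeriv_chartSection hc hy]
  exact hA

end Chart

section Chart

variable {E : Type*} [NormedAddCommGroup E] [NormedSpace ℂ E] [FiniteDimensional ℂ E]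
  {X : Type*} [TopologicalSpace X] [ChartedSpace E X] [IsManifold 𝓘(ℂ, E) ω X]
  (K : KahlerMetric E X) {V : Set X} {φ : X → ℝ} {C : ℝ} {c : OpenPartialHomeomorph X E}

theorem mlieBracket_eq_chart (A B : ∀ p : X, TangentSpace 𝓘(ℝ, E) p) (p : X) :
    VectorField.mlieBracket 𝓘(ℝ, E) A B p = (realDeriv (chartAt E p) p : E →L[ℝ] E).inverse
      (VectorField.lieBracket ℝ (chartSection (chartAt E p) A) (chartSection (chartAt E p) B)
        (chartAt E p p)) := by
  rw [← VectorField.mlieBracketWithin_univ, VectorField.mlieBracketWithin_apply]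
  have hr : Set.range 𝓘(ℝ, E) = Set.univ := 𝓘(ℝ, E).range_eq_univ
  rw [hr, Set.preimage_univ, Set.univ_inter, VectorField.mpullbackWithin_univ,
    VectorField.mpullbackWithin_univ]
  change (realDeriv (chartAt E p) p : E →L[ℝ] E).inverse (VectorField.lieBracketWithin ℝ
    (chartSection (chartAt E p) A) (chartSection (chartAt E p) B) Set.univ (chartAt E p p)) = _
  rw [VectorField.lieBracketWithin_univ]

theorem differentiableAt_chartSection (hc : c ∈ atlas E X) {y : E} (hy : y ∈ c.target)
    {A : ∀ p : X, TangentSpace 𝓘(ℝ, E) p}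
    (hA : ContMDiffAt 𝓘(ℝ, E) 𝓘(ℝ, E).tangent ∞
      (fun p => (⟨p, A p⟩ : TangentBundle 𝓘(ℝ, E) X)) (c.symm y)) :
    DifferentiableAt ℝ (chartSection c A) y := by
  have : FiniteDimensional ℝ E := FiniteDimensional.complexToReal E
  have : CompleteSpace E := FiniteDimensional.complete ℝ E
  have h1 : ContMDiffAt 𝓘(ℝ, E) 𝓘(ℝ, E) ∞ c.symm y :=
    (contMDiffOn_symm_of_mem_maximalAtlas (IsManifold.subset_maximalAtlas hc)).contMDiffAt
      (c.open_target.mem_nhds hy)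
  have hinv : (mfderiv 𝓘(ℝ, E) 𝓘(ℝ, E) c.symm y).IsInvertible :=
    ⟨(mdifferentiable_of_mem_atlas (I := 𝓘(ℝ, E)) hc).symm.mfderiv hy, rfl⟩
  have h2 := ContMDiffAt.mpullback_vectorField_preimage (m := 1) (n := ∞)
    (hA.of_le (by simp)) h1 hinv (by norm_cast)
  exact (contMDiffAt_vectorSpace_iff_contDiffAt.1 h2).differentiableAt (by simp)

theorem isInvolutiveOn_gradDistribution [Nontrivial E] (hφ : K.IsLocalPotential φ V)
    (hC : ∀ p ∈ V, K.gradLengthSq φ p = C) : IsInvolutiveOn (K.gradDistribution φ) V := by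
  intro W hWV hW A B hA hB hAm hBm p hp
  have hc := chart_mem_atlas E p
  have ht := mem_chart_target E p
  have hs := (chartAt E p).left_inv (mem_chart_source E p)
  set c := chartAt E p with hcdef
  have hP := isPotentialOn_chart K hφ hC hc
  have hW' : ∀ᶠ y in 𝓝 (c p), y ∈ c.target ∧ c.symm y ∈ W := by
    have hop := c.isOpen_inter_preimage_symm hW
    exact hop.mem_nhds ⟨ht, by rw [Set.mem_preimage, hs]; exact hp⟩
  have hmem := hP.lieBracket_mem (y := c p) ⟨ht, by simpa [hs] using hWV hp⟩
    (differentiableAt_chartSection (A := A) hc ht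
      (by rw [hs]; exact hA.contMDiffAt (hW.mem_nhds hp)))
    (differentiableAt_chartSection (A := B) hc ht
      (by rw [hs]; exact hB.contMDiffAt (hW.mem_nhds hp)))
    (hW'.mono fun y hy => chartSection_mem K hφ hc hy.1 (hWV hy.2) (hAm _ hy.2))
    (hW'.mono fun y hy => chartSection_mem K hφ hc hy.1 (hWV hy.2) (hBm _ hy.2))
  rw [← chartDeriv_mem_iff K hφ hc ht (by rw [hs]; exact hWV hp)] at hmem
  have heq : chartDeriv c (c p) (VectorField.lieBracket ℝ (chartSection c A) (chartSection c B)
      (c p)) = VectorField.mlieBracket 𝓘(ℝ, E) A B p := by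
    rw [mlieBracket_eq_chart]
    have he := mdifferentiable_of_mem_atlas (I := 𝓘(ℝ, E)) hc
    let L : E ≃L[ℝ] E := he.mfderiv (mem_chart_source E p)
    have hL : (L : E →L[ℝ] E) = realDeriv (chartAt E p) p := rfl
    have hL' : (L.symm : E →L[ℝ] E) = chartDeriv c (c p) := rfl
    rw [← hL, ContinuousLinearMap.inverse_equiv, hL']
  rw [hs] at hmem
  change _ ∈ distAt K φ p
  rw [← heq]
  exact hmem

end Chart

section Parametrization

variable {E : Type*} [NormedAddCommGroup E] [NormedSpace ℂ E] [FiniteDimensional ℂ E]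
  {X : Type*} [TopologicalSpace X] [ChartedSpace E X] [IsManifold 𝓘(ℂ, E) ω X]
  (K : KahlerMetric E X) {V : Set X} {φ : X → ℝ} {C : ℝ} {c : OpenPartialHomeomorph X E}
  {M : Type*} [NormedAddCommGroup M] [NormedSpace ℝ M]

/-- At `z`, the map `ψ` is an immersion onto the distribution generated by the gradient. -/
structure IsTangentAt (φ : X → ℝ) (ψ : M → X) (z : M) : Prop where
  smooth : ContMDiffAt 𝓘(ℝ, M) 𝓘(ℝ, E) ∞ ψ z
  injective : Function.Injective (realDeriv ψ z : M →L[ℝ] E)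
  mem_iff : ∀ v : E, v ∈ distAt K φ (ψ z) ↔ ∃ a, (realDeriv ψ z : M →L[ℝ] E) a = v

variable {K} {ψ : M → X} {z : M}

namespace IsTangentAt

theorem mdifferentiableAt (h : IsTangentAt K φ ψ z) : MDifferentiableAt 𝓘(ℝ, M) 𝓘(ℝ, E) ψ z :=
  h.smooth.mdifferentiableAt (by simp)

theorem contDiffAt (h : IsTangentAt K φ ψ z) (hc : c ∈ atlas E X) (hs : ψ z ∈ c.source) :
    ContDiffAt ℝ ∞ (c ∘ ψ) z := by
  have h1 : ContMDiffAt 𝓘(ℝ, E) 𝓘(ℝ, E) ∞ c (ψ z) :=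
    contMDiffAt_of_mem_maximalAtlas (IsManifold.subset_maximalAtlas hc) hs
  exact contMDiffAt_iff_contDiffAt.1 (h1.comp z h.smooth)

theorem realDeriv_eq (h : IsTangentAt K φ ψ z) (hc : c ∈ atlas E X) (hs : ψ z ∈ c.source)
    (a : M) : (realDeriv ψ z : M →L[ℝ] E) a =
      chartDeriv c (c (ψ z)) (fderiv ℝ (c ∘ ψ) z a) := by
  have he : ψ =ᶠ[𝓝 z] c.symm ∘ (c ∘ ψ) := by
    filter_upwards [h.smooth.continuousAt (c.open_source.mem_nhds hs)] with x hx
    exact (c.left_inv hx).symm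
  have h1 : MDifferentiableAt 𝓘(ℝ, M) 𝓘(ℝ, E) (c ∘ ψ) z :=
    ((h.contDiffAt hc hs).differentiableAt (by simp)).mdifferentiableAt
  have h2 : MDifferentiableAt 𝓘(ℝ, E) 𝓘(ℝ, E) c.symm ((c ∘ ψ) z) :=
    mdifferentiableAt_atlas_symm hc (c.map_source hs)
  have h3 := he.mfderiv_eq.trans (mfderiv_comp z h2 h1)
  rw [mfderiv_eq_fderiv] at h3
  exact DFunLike.congr_fun h3 a

theorem fderiv_injective (h : IsTangentAt K φ ψ z) (hc : c ∈ atlas E X) (hs : ψ z ∈ c.source) :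
    Function.Injective (fderiv ℝ (c ∘ ψ) z) := fun a b hab =>
  h.injective (by rw [h.realDeriv_eq hc hs, h.realDeriv_eq hc hs, hab])

theorem mem_localDistribution_iff (h : IsTangentAt K φ ψ z) (hφ : K.IsLocalPotential φ V)
    (hV : ψ z ∈ V) (hc : c ∈ atlas E X) (hs : ψ z ∈ c.source) (v : E) :
    v ∈ localDistribution (φ ∘ c.symm) (pullback K.inner c.symm) (c (ψ z)) ↔
      ∃ a, fderiv ℝ (c ∘ ψ) z a = v := by
  have ht := c.map_source hs
  rw [← chartDeriv_mem_iff K hφ hc ht (by rwa [c.left_inv hs]), c.left_inv hs, h.mem_iff]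
  simp only [h.realDeriv_eq hc hs, (chartDeriv_bijective hc ht).1.eq_iff]

theorem range_fderiv (h : IsTangentAt K φ ψ z) (hφ : K.IsLocalPotential φ V)
    (hV : ψ z ∈ V) (hc : c ∈ atlas E X) (hs : ψ z ∈ c.source) :
    (fderiv ℝ (c ∘ ψ) z).range =
      localDistribution (φ ∘ c.symm) (pullback K.inner c.symm) (c (ψ z)) := by
  ext v
  rw [h.mem_localDistribution_iff hφ hV hc hs]
  rfl

end IsTangentAt

variable {S : Type*} [TopologicalSpace S] [ChartedSpace (EuclideanSpace ℝ (Fin 2)) S]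
  {ι : S → X}

theorem isTangentAt_of_coordinate
    (hι : IsIntegralSubmanifold (K.gradDistribution φ) V ι) {e : OpenPartialHomeomorph S M}
    (he : ContMDiffOn 𝓘(ℝ, EuclideanSpace ℝ (Fin 2)) 𝓘(ℝ, M) ∞ e e.source)
    (he' : ContMDiffOn 𝓘(ℝ, M) 𝓘(ℝ, EuclideanSpace ℝ (Fin 2)) ∞ e.symm e.target)
    {z : M} (hz : z ∈ e.target) : IsTangentAt K φ (ι ∘ e.symm) z := by
  have hd : e.MDifferentiable 𝓘(ℝ, EuclideanSpace ℝ (Fin 2)) 𝓘(ℝ, M) :=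
    ⟨he.mdifferentiableOn (by simp), he'.mdifferentiableOn (by simp)⟩
  have hbij : Function.Bijective
      (realDeriv e.symm z : M →L[ℝ] EuclideanSpace ℝ (Fin 2)) := hd.symm.mfderiv_bijective hz
  have hcomp : ∀ a, (realDeriv (ι ∘ e.symm) z : M →L[ℝ] E) a =
      (realDeriv ι (e.symm z) : EuclideanSpace ℝ (Fin 2) →L[ℝ] E)
        ((realDeriv e.symm z : M →L[ℝ] EuclideanSpace ℝ (Fin 2)) a) :=
    fun a => DFunLike.congr_fun (mfderiv_comp z (hι.smooth.mdifferentiableAt (by simp))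
      (hd.mdifferentiableAt_symm hz)) a
  refine ⟨(hι.smooth _).comp z (he'.contMDiffAt (e.open_target.mem_nhds hz)), ?_, fun v => ?_⟩
  · intro a b hab
    rw [hcomp, hcomp] at hab
    exact hbij.1 (hι.immersion _ hab)
  · have h1 : v ∈ distAt K φ (ι (e.symm z)) ↔
        ∃ b, (realDeriv ι (e.symm z) : EuclideanSpace ℝ (Fin 2) →L[ℝ] E) b = v := by
      have h2 := SetLike.ext_iff.1 (hι.range_eq (e.symm z)) v
      exact h2.symm
    rw [Function.comp_apply, h1]
    simp only [hcomp]
    exact hbij.2.exists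

theorem isTotallyGeodesic_of_integral [Nontrivial E]
    [IsManifold 𝓘(ℝ, EuclideanSpace ℝ (Fin 2)) ∞ S] (hφ : K.IsLocalPotential φ V)
    (hC : ∀ p ∈ V, K.gradLengthSq φ p = C)
    (hι : IsIntegralSubmanifold (K.gradDistribution φ) V ι) : K.IsTotallyGeodesic ι := by
  intro e he c hc z hz hs a b
  have hP := isPotentialOn_chart K hφ hC hc
  have htan : ∀ x ∈ e.target, IsTangentAt K φ (ι ∘ e.symm) x := fun x hx =>
    isTangentAt_of_coordinate hι
      (contMDiffOn_of_mem_maximalAtlas (IsManifold.subset_maximalAtlas he))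
      (contMDiffOn_symm_of_mem_maximalAtlas (IsManifold.subset_maximalAtlas he)) hx
  have hnear : ∀ᶠ x in 𝓝 z, x ∈ e.target ∧ (ι ∘ e.symm) x ∈ c.source :=
    (e.open_target.eventually_mem hz).and
      ((htan z hz).smooth.continuousAt (c.open_source.mem_nhds hs))
  have hF := (htan z hz).contDiffAt hc hs
  change fderiv ℝ (fderiv ℝ (c ∘ (ι ∘ e.symm))) z a b + christoffel _ ((c ∘ (ι ∘ e.symm)) z)
    (fderiv ℝ (c ∘ (ι ∘ e.symm)) z a) (fderiv ℝ (c ∘ (ι ∘ e.symm)) z b) ∈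
      (fderiv ℝ (c ∘ (ι ∘ e.symm)) z).range
  rw [(htan z hz).range_fderiv hφ (hι.mem _) hc hs]
  have hdd : DifferentiableAt ℝ (fderiv ℝ (c ∘ (ι ∘ e.symm))) z :=
    (hF.fderiv_right (m := 1) (by norm_cast)).differentiableAt (by simp)
  have hY := hdd.hasFDerivAt.clm_apply (hasFDerivAt_const b z)
  have h := hP.covDeriv_mem (F := c ∘ (ι ∘ e.symm)) (a := a)
    (Y := fun x => fderiv ℝ (c ∘ (ι ∘ e.symm)) x b)
    (hF.differentiableAt (by simp)) hY.differentiableAt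
    ⟨c.map_source hs, by
      change c.symm (c (ι (e.symm z))) ∈ V
      rw [c.left_inv hs]; exact hι.mem _⟩
    (hnear.mono fun x hx =>
      ((htan x hx.1).mem_localDistribution_iff hφ (hι.mem _) hc hx.2 _).2 ⟨b, rfl⟩)
    (((htan z hz).mem_localDistribution_iff hφ (hι.mem _) hc hs _).2 ⟨a, rfl⟩)
  rw [hY.fderiv] at h
  simpa using h

theorem hasConstantGaussianCurvature_of_integral [Nontrivial E]
    (hφ : K.IsLocalPotential φ V) (hC : ∀ p ∈ V, K.gradLengthSq φ p = C)
    (hι : IsIntegralSubmanifold (K.gradDistribution φ) V ι) :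
    K.HasConstantGaussianCurvature ι (-2 / C) := by
  intro e he z hz
  set ψ := ι ∘ e.symm with hψ
  have htan : ∀ x ∈ e.target, IsTangentAt K φ ψ x := fun x hx =>
    isTangentAt_of_coordinate hι he.smooth he.smooth_symm hx
  set c := chartAt E (ψ z)
  have hc : c ∈ atlas E X := chart_mem_atlas E _
  have hP := isPotentialOn_chart K hφ hC hc
  have hW : IsOpen (e.target ∩ ψ ⁻¹' c.source) :=
    ContinuousOn.isOpen_inter_preimage
      (fun x hx => (htan x hx).smooth.continuousAt.continuousWithinAt) e.open_target c.open_source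
  have hdiff : DifferentiableOn ℂ (c ∘ ψ) (e.target ∩ ψ ⁻¹' c.source) := fun w hw => by
    have h1 : MDifferentiableAt 𝓘(ℂ, ℂ) 𝓘(ℂ, E) ψ w :=
      (he.holomorphic w hw.1).mdifferentiableAt (e.open_target.mem_nhds hw.1)
    have h2 : MDifferentiableAt 𝓘(ℂ, E) 𝓘(ℂ, E) c (ψ w) := mdifferentiableAt_atlas hc hw.2
    exact (mdifferentiableAt_iff_differentiableAt.1 (h2.comp w h1)).differentiableWithinAt
  have hD1 : ∀ w ∈ e.target ∩ ψ ⁻¹' c.source, deriv (c ∘ ψ) w = fderiv ℝ (c ∘ ψ) w 1 :=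
    fun w hw => by
      rw [((hdiff.differentiableAt (hW.mem_nhds hw)).hasDerivAt.hasFDerivAt.restrictScalars
        ℝ).fderiv]
      simp
  have hQ := hP.comp_holomorphic hW hdiff
    (fun w hw => ⟨c.map_source hw.2, by
      change c.symm (c (ψ w)) ∈ V
      rw [c.left_inv hw.2]; exact hι.mem _⟩)
    (fun w hw h0 => one_ne_zero ((htan w hw.1).fderiv_injective hc hw.2
      (by rw [← hD1 w hw, h0, map_zero])))
    (fun w hw => ((htan w hw.1).mem_localDistribution_iff hφ (hι.mem _) hc hw.2 _).2
      ⟨1, (hD1 w hw).symm⟩)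
  have hzW : z ∈ e.target ∩ ψ ⁻¹' c.source := ⟨hz, mem_chart_source E (ψ z)⟩
  rw [← hQ.gaussianCurvature_eq hzW]
  refine gaussianCurvature_congr ?_
  filter_upwards [hW.mem_nhds hzW] with w hw
  ext u v
  rw [ContinuousLinearMap.bilinearComp_apply, Function.comp_apply, pullback_chart_apply,
    ← (htan w hw.1).realDeriv_eq hc hw.2, ← (htan w hw.1).realDeriv_eq hc hw.2, c.left_inv hw.2]
  rfl

end Parametrization

section HolomorphicCoordinate

theorem eq_smul_localGrad_of_mem {E : Type*} [NormedAddCommGroup E] [NormedSpace ℂ E]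
    {f : E → ℝ} {G : E → E →L[ℝ] E →L[ℝ] ℝ} {y v : E} (l : E →L[ℂ] ℂ)
    (hl : l (localGrad f G y) ≠ 0) (hv : v ∈ localDistribution f G y) :
    v = (l v / l (localGrad f G y)) • localGrad f G y := by
  obtain ⟨a, b, hab⟩ := mem_localDistribution.1 hv
  obtain ⟨c, rfl⟩ : ∃ c : ℂ, v = c • localGrad f G y := by
    refine ⟨a + b * Complex.I, ?_⟩
    rw [← hab, add_smul, mul_smul, Complex.coe_smul, Complex.coe_smul]
  rw [map_smul, smul_eq_mul, mul_div_cancel_right₀ _ hl]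

variable {E : Type*} [NormedAddCommGroup E] [NormedSpace ℂ E] [FiniteDimensional ℂ E]
  {X : Type*} [TopologicalSpace X] [ChartedSpace E X] [IsManifold 𝓘(ℂ, E) ω X]
  {K : KahlerMetric E X} {V : Set X} {φ : X → ℝ} {C : ℝ}
  {S : Type*} [TopologicalSpace S] [ChartedSpace (EuclideanSpace ℝ (Fin 2)) S]
  {ι : S → X}

theorem isHolomorphicCurve_of_integral [Nontrivial E]
    [IsManifold 𝓘(ℝ, EuclideanSpace ℝ (Fin 2)) ∞ S] (hφ : K.IsLocalPotential φ V)
    (hC : ∀ p ∈ V, K.gradLengthSq φ p = C)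
    (hι : IsIntegralSubmanifold (K.gradDistribution φ) V ι) : IsHolomorphicCurve E ι := by
  intro s
  set e₀ := chartAt (EuclideanSpace ℝ (Fin 2)) s with he₀
  have he₀s : ContMDiffOn 𝓘(ℝ, EuclideanSpace ℝ (Fin 2)) 𝓘(ℝ, EuclideanSpace ℝ (Fin 2)) ∞ e₀
    e₀.source := contMDiffOn_chart
  have he₀t : ContMDiffOn 𝓘(ℝ, EuclideanSpace ℝ (Fin 2)) 𝓘(ℝ, EuclideanSpace ℝ (Fin 2)) ∞ e₀.symm
    e₀.target := contMDiffOn_chart_symm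
  set ψ := ι ∘ e₀.symm with hψ
  have hs : s ∈ e₀.source := mem_chart_source _ s
  have hψs : ψ (e₀ s) = ι s := congrArg ι (e₀.left_inv hs)
  set c := chartAt E (ι s)
  have hc : c ∈ atlas E X := chart_mem_atlas E _
  have hP := isPotentialOn_chart K hφ hC hc
  set ξ := localGrad (φ ∘ c.symm) (pullback K.inner c.symm) with hξ
  have htan : ∀ x ∈ e₀.target, IsTangentAt K φ ψ x := fun x hx =>
    isTangentAt_of_coordinate hι he₀s he₀t hx
  have hT : IsOpen (e₀.target ∩ ψ ⁻¹' c.source) :=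
    ContinuousOn.isOpen_inter_preimage
      (fun x hx => (htan x hx).smooth.continuousAt.continuousWithinAt) e₀.open_target c.open_source
  set F := c ∘ ψ with hF
  have hFs : ∀ x ∈ e₀.target ∩ ψ ⁻¹' c.source, ContDiffAt ℝ ∞ F x := fun x hx =>
    (htan x hx.1).contDiffAt hc hx.2
  have hFU : ∀ x ∈ e₀.target ∩ ψ ⁻¹' c.source, F x ∈ c.target ∩ c.symm ⁻¹' V := fun x hx =>
    ⟨c.map_source hx.2, by
      change c.symm (c (ψ x)) ∈ V
      rw [c.left_inv hx.2]; exact hι.mem _⟩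
  have hz₀ : e₀ s ∈ e₀.target ∩ ψ ⁻¹' c.source :=
    ⟨e₀.map_source hs, by rw [Set.mem_preimage, hψs]; exact mem_chart_source E _⟩
  obtain ⟨l, hl⟩ : ∃ l : E →L[ℂ] ℂ, l (ξ (F (e₀ s))) ≠ 0 :=
    SeparatingDual.exists_ne_zero (hP.localGrad_ne_zero (hFU _ hz₀))
  set T := (e₀.target ∩ ψ ⁻¹' c.source) ∩ (fun x => l (ξ (F x))) ⁻¹' {0}ᶜ with hTdef
  have hTo : IsOpen T := by
    refine ContinuousOn.isOpen_inter_preimage (fun x hx => ?_) hT isOpen_compl_singleton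
    exact (l.continuous.continuousAt.comp
      ((hP.differentiableAt_localGrad (hFU x hx)).continuousAt.comp
        (hFs x hx).continuousAt)).continuousWithinAt
  have hsT : e₀ s ∈ T := ⟨hz₀, hl⟩
  let Φ : EuclideanSpace ℝ (Fin 2) → ℂ := fun x => l (F x)
  have hΦs : ∀ x ∈ T, ContDiffAt ℝ ∞ Φ x := fun x hx =>
    (l.restrictScalars ℝ).contDiff.contDiffAt.comp x (hFs x hx.1)
  have hΦd : ∀ x ∈ T, HasFDerivAt Φ ((l.restrictScalars ℝ).comp (fderiv ℝ F x)) x := fun x hx =>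
    (l.restrictScalars ℝ).hasFDerivAt.comp x
      ((hFs x hx.1).differentiableAt (by simp)).hasFDerivAt
  have hDF : ∀ x ∈ T, ∀ a, fderiv ℝ F x a = (l (fderiv ℝ F x a) / l (ξ (F x))) • ξ (F x) :=
    fun x hx a => eq_smul_localGrad_of_mem l hx.2
      (((htan x hx.1.1).mem_localDistribution_iff hφ (hι.mem _) hc hx.1.2 _).2 ⟨a, rfl⟩)
  have hequiv : ∀ x ∈ T, ∃ L : EuclideanSpace ℝ (Fin 2) ≃L[ℝ] ℂ,
      (L : EuclideanSpace ℝ (Fin 2) →L[ℝ] ℂ) = (l.restrictScalars ℝ).comp (fderiv ℝ F x) := by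
    intro x hx
    have hinj : Function.Injective
        ((l.restrictScalars ℝ).comp (fderiv ℝ F x) : EuclideanSpace ℝ (Fin 2) →ₗ[ℝ] ℂ) := by
      intro a b hab
      have hab' : l (fderiv ℝ F x a) = l (fderiv ℝ F x b) := hab
      exact (htan x hx.1.1).fderiv_injective hc hx.1.2
        (by rw [← hF, hDF x hx a, hDF x hx b, hab'])
    exact ⟨(LinearEquiv.ofInjectiveOfFinrankEq _ hinj
      (by rw [finrank_euclideanSpace_fin, Complex.finrank_real_complex])).toContinuousLinearEquiv,
      by ext; rfl⟩
  obtain ⟨L₀, hL₀⟩ := hequiv _ hsT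
  let Θ := ((hΦs _ hsT).toOpenPartialHomeomorph Φ (f' := L₀)
    (by rw [hL₀]; exact hΦd _ hsT) (by simp)).restrOpen T hTo
  have hΘ : ∀ x, Θ x = Φ x := fun x => rfl
  have hΘT : ∀ x ∈ Θ.source, x ∈ T := fun x hx => hx.2
  have hΘs : e₀ s ∈ Θ.source :=
    ⟨(hΦs _ hsT).mem_toOpenPartialHomeomorph_source _ (by simp), hsT⟩
  have hΘd : ∀ w ∈ Θ.target, ∃ L : EuclideanSpace ℝ (Fin 2) ≃L[ℝ] ℂ,
      (L : EuclideanSpace ℝ (Fin 2) →L[ℝ] ℂ) =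
        (l.restrictScalars ℝ).comp (fderiv ℝ F (Θ.symm w)) ∧
      HasFDerivAt Θ (L : EuclideanSpace ℝ (Fin 2) →L[ℝ] ℂ) (Θ.symm w) := fun w hw => by
    have hx := hΘT _ (Θ.map_target hw)
    obtain ⟨L, hL⟩ := hequiv _ hx
    exact ⟨L, hL, by rw [hL]; exact hΦd _ hx⟩
  refine ⟨e₀.trans Θ, ⟨?_, ?_, ?_⟩, ?_⟩
  · intro x hx
    have hx' : x ∈ e₀.source ∧ e₀ x ∈ Θ.source := by simpa using hx
    exact ((hΦs _ (hΘT _ hx'.2)).contMDiffAt.comp x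
      (he₀s.contMDiffAt (e₀.open_source.mem_nhds hx'.1))).contMDiffWithinAt
  · intro w hw
    have hw' : w ∈ Θ.target ∧ Θ.symm w ∈ e₀.target := by simpa using hw
    obtain ⟨L, -, hLd⟩ := hΘd w hw'.1
    exact ((he₀t.contMDiffAt (e₀.open_target.mem_nhds hw'.2)).comp w
      (Θ.contDiffAt_symm hw'.1 hLd
        (hΦs _ (hΘT _ (Θ.map_target hw'.1)))).contMDiffAt).contMDiffWithinAt
  · intro w hw
    have hw' : w ∈ Θ.target ∧ Θ.symm w ∈ e₀.target := by simpa using hw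
    obtain ⟨L, hL, hLd⟩ := hΘd w hw'.1
    set x := Θ.symm w with hx
    have hxT : x ∈ T := hΘT _ (Θ.map_target hw'.1)
    have hsymm := Θ.hasFDerivAt_symm hw'.1 hLd
    have hFx : HasFDerivAt F (fderiv ℝ F x) (Θ.symm w) :=
      ((hFs x hxT.1).differentiableAt (by simp)).hasFDerivAt
    have hcomp := hFx.comp w hsymm
    have hlin : ((ContinuousLinearMap.toSpanSingleton ℂ ((l (ξ (F x)))⁻¹ • ξ (F x))).restrictScalars
        ℝ : ℂ →L[ℝ] E) = (fderiv ℝ F x).comp (L.symm : ℂ →L[ℝ] EuclideanSpace ℝ (Fin 2)) := by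
      refine ContinuousLinearMap.ext fun u => ?_
      have hu : l (fderiv ℝ F x (L.symm u)) = u :=
        (DFunLike.congr_fun hL (L.symm u)).symm.trans (L.apply_symm_apply u)
      rw [ContinuousLinearMap.comp_apply]
      change u • (l (ξ (F x)))⁻¹ • ξ (F x) = fderiv ℝ F x (L.symm u)
      rw [hDF x hxT, hu, smul_smul, div_eq_mul_inv]
    have hholo : HasFDerivAt (F ∘ Θ.symm)
      (ContinuousLinearMap.toSpanSingleton ℂ ((l (ξ (F x)))⁻¹ • ξ (F x))) w :=
      hasFDerivAt_of_restrictScalars ℝ hcomp hlin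
    have h1 : MDifferentiableAt 𝓘(ℂ, E) 𝓘(ℂ, E) c.symm ((F ∘ Θ.symm) w) :=
      mdifferentiableAt_atlas_symm hc (c.map_source hxT.1.2)
    have h2 := h1.comp w hholo.differentiableAt.mdifferentiableAt
    refine (h2.congr_of_eventuallyEq ?_).mdifferentiableWithinAt
    filter_upwards [Θ.open_target.mem_nhds hw'.1] with w' hw₁
    exact (c.left_inv (hΘT _ (Θ.map_target hw₁)).1.2).symm
  · simpa using ⟨hs, hΘs⟩

end HolomorphicCoordinate

end KahlerGrad

end

theorem theorem2p1 {E : Type*} [NormedAddCommGroup E] [NormedSpace ℂ E] [FiniteDimensional ℂ E]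
    [Nontrivial E] {X : Type*} [TopologicalSpace X] [ChartedSpace E X] [IsManifold 𝓘(ℂ, E) ω X]
    (K : KahlerGrad.KahlerMetric E X) (V : Set X) (hV : V.Nonempty) (φ : X → ℝ)
    (hφ : K.IsLocalPotential φ V) (C : ℝ) (hC : ∀ p ∈ V, K.gradLengthSq φ p = C) :
    0 < C ∧
    (∀ p ∈ V, Module.finrank ℝ (K.gradDistribution φ p) = 2) ∧
    KahlerGrad.IsInvolutiveOn (K.gradDistribution φ) V ∧
    ∀ (S : Type*) [TopologicalSpace S] [ChartedSpace (EuclideanSpace ℝ (Fin 2)) S]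
      [IsManifold 𝓘(ℝ, EuclideanSpace ℝ (Fin 2)) ∞ S] (ι : S → X),
      KahlerGrad.IsIntegralSubmanifold (K.gradDistribution φ) V ι →
        KahlerGrad.IsHolomorphicCurve E ι ∧ K.IsTotallyGeodesic ι ∧
          K.HasConstantGaussianCurvature ι (-2 / C) := by
  refine ⟨KahlerGrad.length_pos K hφ hC hV,
    fun p hp => KahlerGrad.finrank_gradDistribution K hφ hC hp,
    KahlerGrad.isInvolutiveOn_gradDistribution K hφ hC, fun S _ _ _ ι hι => ⟨?_, ?_, ?_⟩⟩
  · exact KahlerGrad.isHolomorphicCurve_of_integral hφ hC hι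
  · exact KahlerGrad.isTotallyGeodesic_of_integral hφ hC hι
  · exact KahlerGrad.hasConstantGaussianCurvature_of_integral hφ hC hι
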